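/- Notation. Let $\varphi=(1+\sqrt5)/2$, let $F_0=0,F_1=1,F_k=F_{k-1}+F_{k-2}$, and put $F^m=F_{m+2}$ for integers $m\ge -2$. Every integer $n\ge 0$ is uniquely $n=\sum_j d_jF^j$ with $d_j\in\{0,1\}$ and no two consecutive ones; put $\overline n=\sum_j d_j\varphi^j$ and $|n|=d_0$. For $\mathbf m=(m_1,\dots,m_s)\in\mathbb N_0^s$, an elementary $\mathbf m$-interval is a set $$I=\prod_{j=1}^s\Big[\frac{\overline{a_j}}{\varphi^{m_j}},\frac{\overline{a_j+1}}{\varphi^{m_j}}\Big),\qquad 0\le a_j<F^{m_j};$$ put $|I|=\sum_j(m_j+|a_j|)$, so that $I$ has volume $\varphi^{-|I|}$. It is prime if every $a_j$ has digit $d_1=0$. A set $P\subset[0,1)^s$ of $F^m$ points is (strongly) $\mathbf k$-equidistributed if every prime elementary (respectively: every elementary) $\mathbf k$-interval $I$ contains exactly $F^{m-|I|}$ points of $P$. It is a $(t,m,s)$-net in base $\varphi$ if it is $\mathbf k$-equidistributed for every $\mathbf k\in\mathbb N_0^s$ with $\rho(\mathbf k):=\sum_jk_j+\#\{j:k_j\ne0\}\le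 m+2-t$. A sequence $x_0,x_1,\dots$ is a weak $(t,s)$-sequence in base $\varphi$ if $\{x_0,\dots,x_{F^m-1}\}$ is a $(t,m,s)$-net in base $\varphi$ for all $m\ge t$. A number in $[0,1)$ has at most $n$ digits if it equals $\overline a/\varphi^n$ for some $0\le a<F^n$; its $n$-th digit is $|a|$, where $[\overline a/\varphi^n,\overline{a+1}/\varphi^n)$ is the elementary $n$-interval that contains it. Theorem. (1) Let $m\ge 0$ and let $S_m$ be a $(1,m,2)$-net in base $\varphi$ that is strongly $(m+1,0)$- and strongly $(0,m+1)$-equidistributed, such that all coordinates of all its points have $(m+2)$-nd digit $0$ (for instance, all coordinates have at most $m$ digits). Then there is a $(0,m-1,2)$-net $P_{m-1}$ in base $\varphi$, disjoint from $S_m$ and all of whose coordinates have at most $m+1$ digits, such that $S_m\cup P_{m-1}$ is a $(1,m+1,2)$-net in base $\varphi$ that is strongly $(m+2,0)$-equidistributed and strongly $(0,m+2)$-equidistributed. (2) There is a weak $(1,2)$-sequence $x_0,x_1,x_2,\dots$ in base $\varphi$. It can be chosen with $x_0=(0,0)$ and such that, for every $m\ge 0$, the set $\{x_0,\dots,x_{F^m-1}\}$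 is a $(1,m,2)$-net in base $\varphi$, strongly $(m+1,0)$- and strongly $(0,m+1)$-equidistributed, with all coordinates having at most $m$ digits, and the next $F^{m-1}$ points $\{x_{F^m},\dots,x_{F^{m+1}-1}\}$ form a $(0,m-1,2)$-net in base $\varphi$. -/

import Mathlib

namespace GoldenNet

/-- The shifted Fibonacci numbers `F^m = F_{m+2}`, for integers `m ≥ -2`
(so `F^{-2} = 0`, `F^{-1} = 1`, `F^0 = 1`, `F^1 = 2`, `F^2 = 3`, ...). For `m < -2`, where the
notation is not used, the value is `0`. -/
def fibUp (m : ℤ) : ℕ := Nat.fib (m + 2).toNat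

/-- The digit `d_j` of `n` in its base `𝓕` expansion `n = ∑ d_j F^j` without two consecutive ones,
i.e. in its Zeckendorf representation (Mathlib lists the indices `i` of the Fibonacci numbers
`F_i = F^{i-2}` that occur). -/
def digit (n j : ℕ) : ℕ := if j + 2 ∈ n.zeckendorf then 1 else 0

/-- The `n`-th whole number in base `φ`, `(d_{m-1} ... d_0)_φ = ∑ d_j φ^j`, where the `d_j` are the
base `𝓕` digits of `n`. (A digit `d_j = 1` forces `j < F^j ≤ n`, so `j < n` covers all digits.) -/
noncomputable def whole (n : ℕ) : ℝ :=
  ∑ j ∈ Finset.range n, (digit n j : ℝ) * Real.goldenRatio ^ j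

/-- The interval with left end point `whole a / φ^m` and right end point `whole (a+1) / φ^m`;
for `a < F^m` these are the elementary `m`-intervals, and they partition `[0,1)`. -/
noncomputable def elemIco (m a : ℕ) : Set ℝ :=
  Set.Ico (whole a / Real.goldenRatio ^ m) (whole (a + 1) / Real.goldenRatio ^ m)

/-- The box `∏ j, elemIco (m j) (a j)`. -/
noncomputable def elemBox {s : ℕ} (m a : Fin s → ℕ) : Set (Fin s → ℝ) :=
  {x | ∀ j, x j ∈ elemIco (m j) (a j)}

/-- `|I| = ∑ j, (m j + |a j|)` for the box `I = elemBox m a`, where `|a j|` is the zeroth digit of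
`a j`; the volume of `I` is `φ^{-|I|}`. -/
def boxExp {s : ℕ} (m a : Fin s → ℕ) : ℕ := ∑ j, (m j + digit (a j) 0)

/-- `a` indexes an elementary `m`-interval, i.e. a member of the `m`-partition of `[0,1)^s`. -/
def IsElemIndex {s : ℕ} (m a : Fin s → ℕ) : Prop := ∀ j, a j < fibUp (m j)

/-- `a` indexes a prime elementary `k`-interval: moreover the second-to-last digit of every `a j`
is zero. -/
def IsPrimeIndex {s : ℕ} (k a : Fin s → ℕ) : Prop :=
  ∀ j, a j < fibUp (k j) ∧ digit (a j) 1 = 0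

/-- A point set in `[0,1)^s` with exactly `F^m` points. -/
def IsPointSet {s : ℕ} (m : ℤ) (P : Set (Fin s → ℝ)) : Prop :=
  (∀ x ∈ P, ∀ j, x j ∈ Set.Ico (0 : ℝ) 1) ∧ P.Finite ∧ P.ncard = fibUp m

/-- `k`-equidistribution in base `φ` of a point set with `F^m` points: every prime elementary
`k`-interval `I` contains exactly `F^{m-|I|}` points. -/
def IsEquidistributed {s : ℕ} (m : ℤ) (k : Fin s → ℕ) (P : Set (Fin s → ℝ)) : Prop :=
  IsPointSet m P ∧
    ∀ a, IsPrimeIndex k a → (P ∩ elemBox k a).ncard = fibUp (m - boxExp k a)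

/-- Strong `n`-equidistribution in base `φ` of a point set with `F^m` points: every elementary
interval `I` in the `n`-partition contains exactly `F^{m-|I|}` points. -/
def IsStronglyEquidistributed {s : ℕ} (m : ℤ) (n : Fin s → ℕ) (P : Set (Fin s → ℝ)) : Prop :=
  IsPointSet m P ∧
    ∀ a, IsElemIndex n a → (P ∩ elemBox n a).ncard = fibUp (m - boxExp n a)

/-- `ρ(k)`: the sum of the coordinates of `k` plus the number of nonzero coordinates. -/
def rho {s : ℕ} (k : Fin s → ℕ) : ℕ :=
  ∑ j, k j + (Finset.univ.filter fun j => k j ≠ 0).card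

/-- `(t,m,s)`-nets in base `φ`. -/
def IsNet {s : ℕ} (t : ℕ) (m : ℤ) (P : Set (Fin s → ℝ)) : Prop :=
  IsPointSet m P ∧
    ∀ k : Fin s → ℕ, (rho k : ℤ) ≤ m + 2 - t → IsEquidistributed m k P

/-- The set of the first `F^m` members `x_0, ..., x_{F^m-1}` of a sequence. -/
def firstPoints {s : ℕ} (x : ℕ → Fin s → ℝ) (m : ℕ) : Set (Fin s → ℝ) :=
  x '' Set.Iio (fibUp m)

/-- Weak `(t,s)`-sequences in base `φ`. -/
def IsWeakSequence {s : ℕ} (t : ℕ) (x : ℕ → Fin s → ℝ) : Prop :=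
  ∀ m : ℕ, t ≤ m → IsNet t m (firstPoints x m)

/-- Every coordinate of every point of `P` has an expansion `(.c_1 ... c_n)_φ` with at most `n`
digits, i.e. it is `whole a / φ^n` for some `a < F^n`. -/
def HasDigits {s : ℕ} (n : ℕ) (P : Set (Fin s → ℝ)) : Prop :=
  ∀ x ∈ P, ∀ j, ∃ a < fibUp n, x j = whole a / Real.goldenRatio ^ n

/-- In every coordinate of every point of `P`, the `n`-th base `φ` digit after the point is zero:
the coordinate lies in no elementary `n`-interval whose index has last digit `1`. -/
def NthDigitZero {s : ℕ} (n : ℕ) (P : Set (Fin s → ℝ)) : Prop :=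
  ∀ x ∈ P, ∀ j, ∀ a < fibUp n, digit a 0 = 1 → x j ∉ elemIco n a

end GoldenNet

/-!
The extension step can be read as a statement about words. The elementary `k`-intervals correspond
to the words of `k` binary digits without two consecutive ones, and refining an interval means
appending a digit. The operation `shift` appends the digit `0` to a Zeckendorf representation, and
`shift a + 1` appends the digit `1`, which is possible only if `a` has last digit `0`; every whole
number arises in exactly one of these ways (`exists_shift`). Since `whole (shift a) = φ * whole a`,
this describes how elementary intervals split (`elemIco_split`, `elemIco_shift_of_digit_one`). An
interval with last digit `1` is not split at all, so that an interval that is not prime coincides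
with a prime one that has one digit less, and nets are automatically strongly equidistributed
(`IsNet.isStronglyEquidistributed`).

Let `S` be a `(1, m, 2)`-net and `n = m - 1`. A box of shape `(i, j)` is one that prescribes `i`
digits of the first and `j` digits of the second coordinate. In a shape with `i + j = n`, the
numbers of points of `S` in the boxes are known: they are `2`, or `1` if a last digit is `1`. In a shape with
`i + j = m` they are not known, but each box of shape `i + j = n`, unless both of its last digits
are `1`, is refined in either coordinate into boxes exactly one of which lacks exactly one point
compared with what the extended net needs there (`IsBalanced.refine_cases`). Following these free
boxes, the first `n` digits of one coordinate determine the digits of the other coordinate of a new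
point one by one: a box of shape `(i + 1, j)` is refined to its free part of shape `(i + 1, j + 1)`,
which lies in a box of shape `(i, j + 1)`, and so on (`trace`). Because the free part is also unique
when the first coordinate is refined, every step is a bijection between the boxes of consecutive
shapes (`IsBalanced.existsUnique_trace`). Hence the new points hit every free box exactly once, and
they form a `(0, m - 1, 2)`-net. Both of their coordinates end with the digits `01`, which puts them
into the elementary `(m + 1)`-intervals missed by `S` and makes them disjoint from `S`
(`IsBalanced.exists_isComplement`); for `m = 0` the only new point is `(φ⁻¹, φ⁻¹)`. All
coarser shapes follow from the Fibonacci recurrence.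

The extended net again has all the properties required of `S`, so the sequence is obtained by
iterating the extension, starting with the origin, and listing the new points after the old ones.
-/

namespace GoldenNet

/-! ### The digit shift on Zeckendorf representations -/

theorem isZeckendorfRep_iff (l : List ℕ) :
    l.IsZeckendorfRep ↔ l.Pairwise (fun a b ↦ b + 2 ≤ a) ∧ ∀ a ∈ l, 2 ≤ a := by
  have : IsTrans ℕ (fun a b ↦ b + 2 ≤ a) := ⟨fun a b c h1 h2 ↦ by lia⟩
  rw [List.IsZeckendorfRep, List.isChain_iff_pairwise, List.pairwise_append]
  simp

/-- The number whose base `𝓕` digits are those of `n`, moved up by one place (with `d_0 = 0`). -/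
def shift (n : ℕ) : ℕ := ((n.zeckendorf.map (· + 1)).map Nat.fib).sum

theorem zeckendorf_shift (n : ℕ) : (shift n).zeckendorf = n.zeckendorf.map (· + 1) := by
  refine Nat.zeckendorf_sum_fib ?_
  obtain ⟨h1, h2⟩ := (isZeckendorfRep_iff _).1 (Nat.isZeckendorfRep_zeckendorf n)
  rw [isZeckendorfRep_iff, List.pairwise_map]
  refine ⟨h1.imp fun h ↦ by lia, fun a ha ↦ ?_⟩
  obtain ⟨b, hb, rfl⟩ := List.mem_map.1 ha
  exact (h2 b hb).trans (Nat.le_succ b)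

theorem digit_zero_eq (n : ℕ) : digit n 0 = if 2 ∈ n.zeckendorf then 1 else 0 := rfl

theorem digit_eq_zero_or_one (n j : ℕ) : digit n j = 0 ∨ digit n j = 1 := by
  unfold digit; split_ifs <;> simp

theorem zeckendorf_shift_add_one {n : ℕ} (h : digit n 0 = 0) :
    (shift n + 1).zeckendorf = n.zeckendorf.map (· + 1) ++ [2] := by
  obtain ⟨h1, h2⟩ := (isZeckendorfRep_iff _).1 (Nat.isZeckendorfRep_zeckendorf n)
  have h3 : 2 ∉ n.zeckendorf := fun h3 ↦ by simp [digit_zero_eq, h3] at h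
  have h4 : shift n + 1 = ((n.zeckendorf.map (· + 1) ++ [2]).map Nat.fib).sum := by
    simp [shift]
  rw [h4]
  refine Nat.zeckendorf_sum_fib ((isZeckendorfRep_iff _).2 ⟨?_, ?_⟩)
  · rw [List.pairwise_append, List.pairwise_map]
    refine ⟨h1.imp fun h ↦ by lia, by simp, ?_⟩
    intro a ha b hb
    obtain ⟨c, hc, rfl⟩ := List.mem_map.1 ha
    rw [List.mem_singleton] at hb
    have := h2 c hc
    have : c ≠ 2 := fun h ↦ h3 (h ▸ hc)
    lia
  · intro a ha
    rcases List.mem_append.1 ha with ha | ha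
    · obtain ⟨c, hc, rfl⟩ := List.mem_map.1 ha
      exact (h2 c hc).trans (Nat.le_succ c)
    · rw [List.mem_singleton.1 ha]

/-- Every whole number arises from appending a last digit: `0` to any number, or `1` to a number
with last digit `0`. -/
theorem exists_shift (b : ℕ) : ∃ a, b = shift a ∨ (digit a 0 = 0 ∧ b = shift a + 1) := by
  obtain ⟨h1, h2⟩ := (isZeckendorfRep_iff _).1 (Nat.isZeckendorfRep_zeckendorf b)
  -- Lists of indices `≥ 3` are shifts.
  have key : ∀ l : List ℕ, l.Pairwise (fun a b ↦ b + 2 ≤ a) → (∀ a ∈ l, 3 ≤ a) →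
      ∃ a : ℕ, (l.map Nat.fib).sum = shift a ∧ a.zeckendorf = l.map (· - 1) := by
    intro l hl hl'
    have h3 : (l.map (· - 1)).IsZeckendorfRep := by
      rw [isZeckendorfRep_iff, List.pairwise_map]
      refine ⟨hl.imp_of_mem fun {a b} ha hb h ↦ ?_, fun a ha ↦ ?_⟩
      · have := hl' a ha; have := hl' b hb; lia
      · obtain ⟨c, hc, rfl⟩ := List.mem_map.1 ha
        have := hl' c hc; lia
    refine ⟨((l.map (· - 1)).map Nat.fib).sum, ?_, Nat.zeckendorf_sum_fib h3⟩
    rw [shift, Nat.zeckendorf_sum_fib h3, List.map_map, List.map_map]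
    congr 1
    refine List.map_congr_left fun a ha ↦ ?_
    have := hl' a ha
    simp only [Function.comp_apply]
    congr 1; lia
  by_cases h : 2 ∈ b.zeckendorf
  · obtain ⟨l, r, hlr⟩ := List.append_of_mem h
    rw [hlr] at h1 h2
    rw [List.pairwise_append, List.pairwise_cons] at h1
    -- Nothing smaller than `2` can follow the index `2`.
    have hr : r = [] := by
      refine List.eq_nil_iff_forall_not_mem.2 fun c hc ↦ ?_
      have := h1.2.1.1 c hc; have := h2 c (by simp [hc]); lia
    have hl3 : ∀ a ∈ l, 4 ≤ a := fun a ha ↦ h1.2.2 a ha 2 (by simp)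
    obtain ⟨a, ha, ha'⟩ := key l h1.1 fun a ha ↦ by have := hl3 a ha; lia
    refine ⟨a, Or.inr ⟨?_, ?_⟩⟩
    · rw [digit_zero_eq, if_neg]
      rw [ha']
      intro hm
      obtain ⟨c, hc, hc'⟩ := List.mem_map.1 hm
      have := hl3 c hc; lia
    · rw [← Nat.sum_zeckendorf_fib b, hlr, hr, ← ha]; simp
  · obtain ⟨a, ha, -⟩ := key _ h1 fun c hc ↦ by
      have := h2 c hc
      have : c ≠ 2 := fun h' ↦ h (h' ▸ hc)
      lia
    exact ⟨a, Or.inl (by rw [← ha, Nat.sum_zeckendorf_fib])⟩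

theorem digit_shift_zero (n : ℕ) : digit (shift n) 0 = 0 := by
  rw [digit_zero_eq, zeckendorf_shift, if_neg]
  intro h
  obtain ⟨c, hc, hc'⟩ := List.mem_map.1 h
  have := ((isZeckendorfRep_iff _).1 (Nat.isZeckendorfRep_zeckendorf n)).2 c hc
  lia

theorem digit_shift_one (n : ℕ) : digit (shift n) 1 = digit n 0 := by
  simp [digit, zeckendorf_shift]

theorem digit_shift_add_one_zero {n : ℕ} (h : digit n 0 = 0) : digit (shift n + 1) 0 = 1 := by
  simp only [digit, zeckendorf_shift_add_one h]; simp

theorem digit_shift_add_one_one {n : ℕ} (h : digit n 0 = 0) : digit (shift n + 1) 1 = 0 := by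
  have : 2 ∉ n.zeckendorf := fun h3 ↦ by simp [digit_zero_eq, h3] at h
  simp only [digit, zeckendorf_shift_add_one h]; simp [this]

theorem shift_shift (n : ℕ) : shift (shift n) = shift n + n := by
  have h : ∀ l : List ℕ, (((l.map (· + 1)).map (· + 1)).map Nat.fib).sum =
      ((l.map (· + 1)).map Nat.fib).sum + (l.map Nat.fib).sum := by
    intro l
    induction l with
    | nil => simp
    | cons a l ih =>
      simp only [List.map_cons, List.sum_cons] at ih ⊢
      rw [ih, add_assoc a, Nat.fib_add_two]; ring
  have h1 := h n.zeckendorf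
  rw [Nat.sum_zeckendorf_fib] at h1
  rw [shift, zeckendorf_shift, h1, shift]

theorem shift_shift_add_one {n : ℕ} (h : digit n 0 = 0) :
    shift (shift n + 1) = shift (shift n) + 2 := by
  rw [shift, zeckendorf_shift_add_one h, shift, zeckendorf_shift]
  simp [Nat.fib]

theorem shift_zero : shift 0 = 0 := by simp [shift]

theorem digit_zero_left (j : ℕ) : digit 0 j = 0 := by simp [digit]

theorem lt_shift : ∀ {n : ℕ}, 0 < n → n < shift n := by
  intro n hn
  have h : ∀ l : List ℕ, (∀ a ∈ l, 2 ≤ a) →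
      (l.map Nat.fib).sum + l.length ≤ ((l.map (· + 1)).map Nat.fib).sum := by
    intro l hl
    induction l with
    | nil => simp
    | cons a l ih =>
      have h2 : 2 ≤ a := hl a (by simp)
      have := ih fun b hb ↦ hl b (by simp [hb])
      have := Nat.fib_lt_fib_succ h2
      simp only [List.map_cons, List.sum_cons, List.length_cons] at this ⊢
      lia
  have h1 := h _ ((isZeckendorfRep_iff _).1 (Nat.isZeckendorfRep_zeckendorf n)).2
  rw [Nat.sum_zeckendorf_fib] at h1
  have : 0 < n.zeckendorf.length := by simp [hn]
  unfold shift
  lia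

/-- The gap between consecutive shifts: it is `2` if the digit `1` may be appended, `1` if not. -/
theorem shift_succ (n : ℕ) : shift (n + 1) + digit n 0 = shift n + 2 := by
  induction n using Nat.strong_induction_on with
  | _ n ih =>
  -- The claim for `n` follows from that for its parent `c`, as `shift (shift c) = shift c + c`.
  obtain ⟨c, rfl | ⟨hc, rfl⟩⟩ := exists_shift n
  · rcases Nat.eq_zero_or_pos c with rfl | hpos
    · simp [digit_zero_left, shift, Nat.greatestFib, Nat.findGreatest, Nat.fib]
    rw [digit_shift_zero, add_zero]
    rcases digit_eq_zero_or_one c 0 with h | h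
    · exact shift_shift_add_one h
    · have := ih c (lt_shift hpos)
      rw [h] at this
      have h2 := shift_shift (c + 1)
      have h3 := shift_shift c
      have h4 : shift c + 1 = shift (c + 1) := by lia
      rw [h4]; lia
  · have hlt : c < shift c + 1 := by
      rcases Nat.eq_zero_or_pos c with rfl | hpos
      · simp
      · exact (lt_shift hpos).trans (Nat.lt_succ_self _)
    have := ih c hlt
    rw [hc, add_zero] at this
    rw [digit_shift_add_one_zero hc, add_assoc, show 1 + 1 = 2 from rfl, ← this,
      shift_shift_add_one hc, shift_shift, shift_shift]
    lia

theorem shift_strictMono : StrictMono shift := by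
  refine strictMono_nat_of_lt_succ fun n ↦ ?_
  have := shift_succ n
  rcases digit_eq_zero_or_one n 0 with h | h <;> lia

theorem shift_fib (k : ℕ) : shift (Nat.fib (k + 2)) = Nat.fib (k + 3) := by
  have h : (Nat.fib (k + 2)).zeckendorf = [k + 2] := by
    have := Nat.zeckendorf_sum_fib (l := [k + 2]) (by rw [isZeckendorfRep_iff]; simp)
    simpa only [List.map_cons, List.map_nil, List.sum_cons, List.sum_nil, add_zero] using this
  rw [shift, h]; simp

theorem fibUp_natCast (k : ℕ) : fibUp k = Nat.fib (k + 2) := by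
  unfold fibUp; congr 1

theorem shift_fibUp (k : ℕ) : shift (fibUp k) = fibUp ((k + 1 : ℕ) : ℤ) := by
  rw [fibUp_natCast, fibUp_natCast, shift_fib]

theorem shift_lt_fibUp_iff {k a : ℕ} : shift a < fibUp ((k + 1 : ℕ) : ℤ) ↔ a < fibUp k := by
  rw [← shift_fibUp, shift_strictMono.lt_iff_lt]

theorem shift_add_one_lt_fibUp_iff {k a : ℕ} (h : digit a 0 = 0) :
    shift a + 1 < fibUp ((k + 1 : ℕ) : ℤ) ↔ a < fibUp k := by
  refine ⟨fun h1 ↦ shift_lt_fibUp_iff.1 (by lia), fun h1 ↦ ?_⟩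
  have := shift_succ a
  have h2 := shift_strictMono.monotone (Nat.succ_le_of_lt h1)
  rw [shift_fibUp, Nat.succ_eq_add_one] at h2
  lia

/-- Deletion of the last base `𝓕` digit. -/
noncomputable def parent (b : ℕ) : ℕ := (exists_shift b).choose

theorem eq_shift_parent (b : ℕ) :
    b = shift (parent b) ∨ (digit (parent b) 0 = 0 ∧ b = shift (parent b) + 1) :=
  (exists_shift b).choose_spec

theorem shift_ne_shift_add_one {a c : ℕ} (hc : digit c 0 = 0) : shift a ≠ shift c + 1 := by
  intro h
  have h1 := digit_shift_zero a
  rw [h, digit_shift_add_one_zero hc] at h1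
  lia

theorem parent_shift (a : ℕ) : parent (shift a) = a := by
  rcases eq_shift_parent (shift a) with h | ⟨h0, h⟩
  · exact (shift_strictMono.injective h).symm
  · exact absurd h (shift_ne_shift_add_one h0)

theorem parent_shift_add_one {a : ℕ} (ha : digit a 0 = 0) : parent (shift a + 1) = a := by
  rcases eq_shift_parent (shift a + 1) with h | ⟨h0, h⟩
  · exact absurd h.symm (shift_ne_shift_add_one ha)
  · exact (shift_strictMono.injective (Nat.succ_injective h)).symm

theorem parent_lt_fibUp_iff {k b : ℕ} : parent b < fibUp k ↔ b < fibUp ((k + 1 : ℕ) : ℤ) := by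
  rcases eq_shift_parent b with h | ⟨h0, h⟩
  · conv_rhs => rw [h]
    exact shift_lt_fibUp_iff.symm
  · conv_rhs => rw [h]
    exact (shift_add_one_lt_fibUp_iff h0).symm

theorem parent_eq_iff {a b : ℕ} :
    parent b = a ↔ b = shift a ∨ (digit a 0 = 0 ∧ b = shift a + 1) := by
  constructor
  · rintro rfl; exact eq_shift_parent b
  · rintro (rfl | ⟨h, rfl⟩)
    · exact parent_shift a
    · exact parent_shift_add_one h

/-! ### Elementary intervals -/

theorem whole_eq_sum (n : ℕ) :
    whole n = (n.zeckendorf.map fun i ↦ Real.goldenRatio ^ (i - 2)).sum := by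
  obtain ⟨h1, h2⟩ := (isZeckendorfRep_iff _).1 (Nat.isZeckendorfRep_zeckendorf n)
  have hnd : n.zeckendorf.Nodup := h1.imp fun h ↦ by lia
  have hlt : ∀ i ∈ n.zeckendorf, i - 2 < n := by
    intro i hi
    have h3 : Nat.fib i ≤ n := by
      conv_rhs => rw [← Nat.sum_zeckendorf_fib n]
      exact List.single_le_sum (by simp) _ (List.mem_map_of_mem hi)
    have h4 := h2 i hi
    have h5 := Nat.le_fib_add_one i
    lia
  rw [whole, ← List.sum_toFinset _ hnd]
  have : ∀ j ∈ Finset.range n, (digit n j : ℝ) * Real.goldenRatio ^ j =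
      if j + 2 ∈ n.zeckendorf then Real.goldenRatio ^ j else 0 := by
    intro j _; unfold digit; split_ifs <;> simp
  rw [Finset.sum_congr rfl this, ← Finset.sum_filter]
  refine Finset.sum_bij' (fun j _ ↦ j + 2) (fun i _ ↦ i - 2) ?_ ?_ ?_ ?_ ?_
  · intro j hj; simpa using (Finset.mem_filter.1 hj).2
  · intro i hi
    have hi := List.mem_toFinset.1 hi
    rw [Finset.mem_filter, Finset.mem_range, Nat.sub_add_cancel (h2 i hi)]
    exact ⟨hlt i hi, hi⟩
  · simp
  · intro i hi; exact Nat.sub_add_cancel (h2 i (List.mem_toFinset.1 hi))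
  · simp

theorem whole_shift (n : ℕ) : whole (shift n) = Real.goldenRatio * whole n := by
  rw [whole_eq_sum, whole_eq_sum, zeckendorf_shift, List.map_map, ← List.sum_map_mul_left]
  congr 1
  refine List.map_congr_left fun i hi ↦ ?_
  have := ((isZeckendorfRep_iff _).1 (Nat.isZeckendorfRep_zeckendorf n)).2 i hi
  rw [Function.comp_apply, ← pow_succ']
  congr 1; lia

theorem whole_shift_add_one {n : ℕ} (h : digit n 0 = 0) :
    whole (shift n + 1) = whole (shift n) + 1 := by
  rw [whole_eq_sum, whole_eq_sum, zeckendorf_shift, zeckendorf_shift_add_one h]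
  simp

theorem whole_zero : whole 0 = 0 := by simp [whole]

theorem whole_one : whole 1 = 1 := by
  have := whole_shift_add_one (digit_zero_left 0)
  simpa [shift_zero, whole_zero] using this

/-- Consecutive whole numbers differ by `1` or by `φ - 1 = φ⁻¹`. -/
theorem whole_succ (n : ℕ) :
    (digit n 0 = 0 → whole (n + 1) = whole n + 1) ∧
    (digit n 0 = 1 → whole (n + 1) = whole n + (Real.goldenRatio - 1)) := by
  induction n using Nat.strong_induction_on with
  | _ n ih =>
  have hlt : ∀ c, c < shift c + 1 := fun c ↦ by
    rcases Nat.eq_zero_or_pos c with rfl | hpos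
    · simp
    · exact (lt_shift hpos).trans (Nat.lt_succ_self _)
  obtain ⟨c, rfl | ⟨hc, rfl⟩⟩ := exists_shift n
  · refine ⟨fun _ ↦ ?_, fun h ↦ by simp [digit_shift_zero] at h⟩
    rcases digit_eq_zero_or_one c 0 with h | h
    · exact whole_shift_add_one h
    · have h1 : shift c + 1 = shift (c + 1) := by have := shift_succ c; lia
      have hpos : 0 < c := Nat.pos_of_ne_zero fun h0 ↦ by simp [h0, digit_zero_left] at h
      rw [h1, whole_shift, whole_shift, (ih c (lt_shift hpos)).2 h]
      linear_combination Real.goldenRatio_sq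
  · refine ⟨fun h ↦ by simp [digit_shift_add_one_zero hc] at h, fun _ ↦ ?_⟩
    have h1 : shift c + 1 + 1 = shift (c + 1) := by have := shift_succ c; lia
    rw [h1, whole_shift_add_one hc, whole_shift, whole_shift, (ih c (hlt c)).1 hc]
    ring

theorem whole_strictMono : StrictMono whole := by
  refine strictMono_nat_of_lt_succ fun n ↦ ?_
  rcases digit_eq_zero_or_one n 0 with h | h
  · rw [(whole_succ n).1 h]; linarith
  · rw [(whole_succ n).2 h]; linarith [Real.one_lt_goldenRatio]

theorem left_mem_elemIco (k a : ℕ) : whole a / Real.goldenRatio ^ k ∈ elemIco k a :=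
  ⟨le_rfl, by gcongr; exact whole_strictMono (Nat.lt_succ_self a)⟩

theorem elemIco_disjoint {k a b : ℕ} {x : ℝ} (ha : x ∈ elemIco k a) (hb : x ∈ elemIco k b) :
    a = b := by
  have key : ∀ {a b : ℕ}, x ∈ elemIco k a → x ∈ elemIco k b → b ≤ a := by
    intro a b ha hb
    have h := hb.1.trans_lt ha.2
    rw [div_lt_div_iff_of_pos_right (pow_pos Real.goldenRatio_pos _)] at h
    exact Nat.lt_succ_iff.1 (whole_strictMono.lt_iff_lt.1 h)
  exact le_antisymm (key hb ha) (key ha hb)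

theorem elemIco_zero_zero : elemIco 0 0 = Set.Ico 0 1 := by
  simp [elemIco, whole_zero, whole_one]

theorem whole_shift_div (k a : ℕ) :
    whole (shift a) / Real.goldenRatio ^ (k + 1) = whole a / Real.goldenRatio ^ k := by
  rw [whole_shift, pow_succ', mul_div_mul_left _ _ Real.goldenRatio_ne_zero]

/-- An interval whose last digit is `1` is not split by the next digit. -/
theorem elemIco_shift_of_digit_one {k a : ℕ} (h : digit a 0 = 1) :
    elemIco (k + 1) (shift a) = elemIco k a := by
  have h1 : shift a + 1 = shift (a + 1) := by have := shift_succ a; lia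
  rw [elemIco, h1, whole_shift_div, whole_shift_div, elemIco]

theorem elemIco_split {k a : ℕ} (h : digit a 0 = 0) :
    elemIco k a = elemIco (k + 1) (shift a) ∪ elemIco (k + 1) (shift a + 1) := by
  have h1 : shift a + 1 + 1 = shift (a + 1) := by have := shift_succ a; lia
  have h2 : shift a < shift a + 1 := Nat.lt_succ_self _
  have h3 : shift a + 1 < shift a + 1 + 1 := Nat.lt_succ_self _
  rw [elemIco, elemIco, elemIco, Set.Ico_union_Ico_eq_Ico, h1, whole_shift_div, whole_shift_div]
  · gcongr; exact (whole_strictMono h2).le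
  · gcongr; exact (whole_strictMono h3).le

theorem elemIco_subset_parent (k b : ℕ) : elemIco (k + 1) b ⊆ elemIco k (parent b) := by
  rcases digit_eq_zero_or_one (parent b) 0 with h | h
  · rw [elemIco_split h]
    rcases eq_shift_parent b with h1 | ⟨_, h1⟩ <;> rw [← h1]
    · exact Set.subset_union_left
    · exact Set.subset_union_right
  · rw [← elemIco_shift_of_digit_one h]
    rcases eq_shift_parent b with h1 | ⟨h0, h1⟩
    · rw [← h1]
    · lia

theorem exists_mem_elemIco (k : ℕ) {x : ℝ} (hx : x ∈ Set.Ico (0 : ℝ) 1) :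
    ∃ a < fibUp k, x ∈ elemIco k a := by
  induction k with
  | zero => exact ⟨0, by simp [fibUp], by rwa [elemIco_zero_zero]⟩
  | succ k ih =>
    obtain ⟨a, ha, hxa⟩ := ih
    rcases digit_eq_zero_or_one a 0 with h | h
    · rw [elemIco_split h] at hxa
      rcases hxa with hxa | hxa
      · exact ⟨_, shift_lt_fibUp_iff.2 ha, hxa⟩
      · exact ⟨_, (shift_add_one_lt_fibUp_iff h).2 ha, hxa⟩
    · rw [← elemIco_shift_of_digit_one h] at hxa
      exact ⟨_, shift_lt_fibUp_iff.2 ha, hxa⟩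

theorem elemIco_subset_Ico {k a : ℕ} (ha : a < fibUp k) : elemIco k a ⊆ Set.Ico 0 1 := by
  induction k generalizing a with
  | zero =>
    have : a = 0 := by simpa [fibUp] using ha
    rw [this, elemIco_zero_zero]
  | succ k ih => exact (elemIco_subset_parent k a).trans (ih (parent_lt_fibUp_iff.2 ha))

theorem elemIco_subset_iterate_parent (k j b : ℕ) :
    elemIco (k + j) b ⊆ elemIco k (parent^[j] b) := by
  induction j generalizing b with
  | zero => rfl
  | succ j ih => exact (elemIco_subset_parent _ b).trans (ih _)

theorem iterate_parent_lt_fibUp {k j b : ℕ} (hb : b < fibUp ((k + j : ℕ) : ℤ)) :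
    parent^[j] b < fibUp k := by
  induction j generalizing b with
  | zero => exact hb
  | succ j ih => exact ih (parent_lt_fibUp_iff.2 hb)

/-- Membership of a point in a coarser interval is read off from the index of a finer one. -/
theorem mem_elemIco_iff_iterate_parent {k j b a : ℕ} {x : ℝ} (hx : x ∈ elemIco (k + j) b) :
    x ∈ elemIco k a ↔ parent^[j] b = a :=
  ⟨fun h ↦ elemIco_disjoint (elemIco_subset_iterate_parent k j b hx) h,
    fun h ↦ h ▸ elemIco_subset_iterate_parent k j b hx⟩

/-! ### Fibonacci counts -/

theorem fibUp_eq_add {e : ℤ} (he : 0 ≤ e) : fibUp e = fibUp (e - 1) + fibUp (e - 2) := by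
  obtain ⟨n, rfl⟩ := Int.eq_ofNat_of_zero_le he
  have h0 : ((n : ℤ) + 2).toNat = n + 2 := by lia
  have h1 : ((n : ℤ) - 1 + 2).toNat = n + 1 := by lia
  have h2 : ((n : ℤ) - 2 + 2).toNat = n := by lia
  simp only [fibUp]
  rw [h0, h1, h2, Nat.fib_add_two, add_comm]

theorem fibUp_neg_two : fibUp (-2) = 0 := by decide

/-! ### Tracing the missing half boxes -/

/-- `fibUp (1 - |u| - |v|)`: the number of points that strong equidistribution of a set with `F^M`
points demands in the box with index `(u, v)` in a shape `(i, j)` with `i + j = M - 1`. For a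
given net with `F^m` points it is used in the shapes with `i + j = m - 1`, for the extended net in
those with `i + j = m`. -/
def capacity (u v : ℕ) : ℕ := fibUp (1 - digit u 0 - digit v 0)

theorem capacity_comm (u v : ℕ) : capacity u v = capacity v u := by
  unfold capacity; congr 1; ring

theorem capacity_eq_two {u v : ℕ} (hu : digit u 0 = 0) (hv : digit v 0 = 0) :
    capacity u v = 2 := by
  rw [capacity, hu, hv]; rfl

theorem capacity_eq_one {u v : ℕ} (h : digit u 0 = 1 ∨ digit v 0 = 1) : capacity u v = 1 := by
  unfold capacity
  rcases digit_eq_zero_or_one u 0 with hu | hu <;> rcases digit_eq_zero_or_one v 0 with hv | hv <;>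
    rw [hu, hv] at h ⊢ <;> first | rfl | lia

/-- `N i j u v` behaves like the number of points in the box with index `(u, v)` in shape `(i, j)`:
it is additive with respect to the refinement of boxes in either coordinate. -/
structure IsBoxCount (N : ℕ → ℕ → ℕ → ℕ → ℕ) : Prop where
  fst_zero : ∀ i j u v, digit u 0 = 0 →
    N i j u v = N (i + 1) j (shift u) v + N (i + 1) j (shift u + 1) v
  fst_one : ∀ i j u v, digit u 0 = 1 → N i j u v = N (i + 1) j (shift u) v
  snd_zero : ∀ i j u v, digit v 0 = 0 →
    N i j u v = N i (j + 1) u (shift v) + N i (j + 1) u (shift v + 1)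
  snd_one : ∀ i j u v, digit v 0 = 1 → N i j u v = N i (j + 1) u (shift v)

theorem IsBoxCount.flip {N : ℕ → ℕ → ℕ → ℕ → ℕ} (h : IsBoxCount N) :
    IsBoxCount fun i j u v ↦ N j i v u :=
  ⟨fun i j u v ↦ h.snd_zero j i v u, fun i j u v ↦ h.snd_one j i v u,
    fun i j u v ↦ h.fst_zero j i v u, fun i j u v ↦ h.fst_one j i v u⟩

theorem IsBoxCount.le_parent {N : ℕ → ℕ → ℕ → ℕ → ℕ} (h : IsBoxCount N) (i j u v : ℕ) :
    N (i + 1) j u v ≤ N i j (parent u) v := by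
  rcases digit_eq_zero_or_one (parent u) 0 with h0 | h0
  · rw [h.fst_zero _ _ _ _ h0]
    rcases eq_shift_parent u with h1 | ⟨_, h1⟩ <;> rw [← h1] <;> lia
  · rw [h.fst_one _ _ _ _ h0]
    rcases eq_shift_parent u with h1 | ⟨h2, h1⟩
    · rw [← h1]
    · lia

/-- A box count that attains the capacity of every box in all shapes `(i, j)` with `i + j = n`. -/
structure IsBalanced (n : ℕ) (N : ℕ → ℕ → ℕ → ℕ → ℕ) : Prop extends IsBoxCount N where
  eq_capacity : ∀ i j u v : ℕ, i + j = n → u < fibUp i → v < fibUp j → N i j u v = capacity u v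

theorem IsBalanced.flip {n : ℕ} {N : ℕ → ℕ → ℕ → ℕ → ℕ} (h : IsBalanced n N) :
    IsBalanced n fun i j u v ↦ N j i v u :=
  ⟨h.toIsBoxCount.flip, fun i j u v hij hu hv ↦ by
    rw [capacity_comm]; exact h.eq_capacity j i v u (by lia) hv hu⟩

/-- The box with index `(u, v)` in shape `(i, j)` lacks exactly one point to reach its capacity. -/
def IsFree (N : ℕ → ℕ → ℕ → ℕ → ℕ) (i j u v : ℕ) : Prop := N i j u v + 1 = capacity u v

theorem isFree_flip {N : ℕ → ℕ → ℕ → ℕ → ℕ} {i j u v : ℕ} :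
    IsFree (fun i j u v ↦ N j i v u) j i v u ↔ IsFree N i j u v := by
  rw [IsFree, IsFree, capacity_comm]

section step

variable {n i j u v : ℕ} {N : ℕ → ℕ → ℕ → ℕ → ℕ}

/-- How the free and the full halves of the box with index `(u, v)` in shape `i + 1 + j = n` are
distributed when the second coordinate is refined. -/
theorem IsBalanced.refine_cases (hN : IsBalanced n N) (hij : i + 1 + j = n)
    (hu : u < fibUp ((i + 1 : ℕ) : ℤ)) (hv : v < fibUp j) :
    (digit u 0 = 1 ∧ digit v 0 = 1 ∧ N (i + 1) (j + 1) u (shift v) = capacity u (shift v)) ∨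
    (digit u 0 = 0 ∧ digit v 0 = 1 ∧ IsFree N (i + 1) (j + 1) u (shift v)) ∨
    (digit v 0 = 0 ∧ IsFree N (i + 1) (j + 1) u (shift v) ∧
      N (i + 1) (j + 1) u (shift v + 1) = capacity u (shift v + 1)) ∨
    (digit v 0 = 0 ∧ N (i + 1) (j + 1) u (shift v) = capacity u (shift v) ∧
      IsFree N (i + 1) (j + 1) u (shift v + 1)) := by
  have hval := hN.eq_capacity (i + 1) j u v hij hu hv
  rcases digit_eq_zero_or_one v 0 with h0 | h0
  · have hc1 : capacity u (shift v + 1) = 1 :=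
      capacity_eq_one (Or.inr (digit_shift_add_one_zero h0))
    -- The box with last digit `1` has at most one point, by refining the other coordinate first.
    have hle : N (i + 1) (j + 1) u (shift v + 1) ≤ 1 := by
      refine (hN.le_parent _ _ _ _).trans ?_
      rw [hN.eq_capacity i (j + 1) _ _ (by lia) (parent_lt_fibUp_iff.2 hu)
        ((shift_add_one_lt_fibUp_iff h0).2 hv),
        capacity_eq_one (Or.inr (digit_shift_add_one_zero h0))]
    rw [hN.snd_zero _ _ _ _ h0] at hval
    unfold IsFree
    rcases digit_eq_zero_or_one u 0 with h1 | h1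
    · rw [capacity_eq_two h1 h0] at hval
      rw [capacity_eq_two h1 (digit_shift_zero v), hc1]
      lia
    · rw [capacity_eq_one (Or.inl h1)] at hval
      rw [capacity_eq_one (Or.inl h1), hc1]
      lia
  · rw [hN.snd_one _ _ _ _ h0, capacity_eq_one (Or.inr h0)] at hval
    unfold IsFree
    rcases digit_eq_zero_or_one u 0 with h1 | h1
    · rw [capacity_eq_two h1 (digit_shift_zero v)]; lia
    · rw [capacity_eq_one (Or.inl h1)]; lia

theorem not_isFree_of_eq (h : N i j u v = capacity u v) : ¬ IsFree N i j u v := by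
  unfold IsFree; lia

theorem IsBalanced.exists_isFree (hN : IsBalanced n N) (hij : i + 1 + j = n)
    (hu : u < fibUp ((i + 1 : ℕ) : ℤ)) (hv : v < fibUp j) (h : digit u 0 = 0 ∨ digit v 0 = 0) :
    ∃! w, parent w = v ∧ IsFree N (i + 1) (j + 1) u w := by
  simp only [parent_eq_iff]
  rcases hN.refine_cases hij hu hv with ⟨h1, h2, -⟩ | ⟨h1, h2, h3⟩ | ⟨h1, h2, h3⟩ | ⟨h1, h2, h3⟩
  · lia
  · refine ⟨_, ⟨Or.inl rfl, h3⟩, ?_⟩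
    rintro _ ⟨rfl | ⟨h4, rfl⟩, -⟩
    · rfl
    · lia
  · refine ⟨_, ⟨Or.inl rfl, h2⟩, ?_⟩
    rintro _ ⟨rfl | ⟨h4, rfl⟩, h5⟩
    · rfl
    · exact absurd h5 (not_isFree_of_eq h3)
  · refine ⟨_, ⟨Or.inr ⟨h1, rfl⟩, h3⟩, ?_⟩
    rintro _ ⟨rfl | ⟨h4, rfl⟩, h5⟩
    · exact absurd h5 (not_isFree_of_eq h2)
    · rfl

theorem IsBalanced.isFree_or_eq (hN : IsBalanced n N) (hij : i + 1 + j = n)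
    (hu : u < fibUp ((i + 1 : ℕ) : ℤ)) (hv : v < fibUp ((j + 1 : ℕ) : ℤ)) :
    IsFree N (i + 1) (j + 1) u v ∨ N (i + 1) (j + 1) u v = capacity u v := by
  have h := hN.refine_cases hij hu (parent_lt_fibUp_iff.2 hv)
  rcases eq_shift_parent v with h1 | ⟨h0, h1⟩
  · rw [← h1] at h; tauto
  · rw [← h1] at h
    rcases h with h | h | h | h
    · lia
    · lia
    · exact Or.inr h.2.2
    · exact Or.inl h.2.2

theorem IsBalanced.digit_of_isFree (hN : IsBalanced n N) (hij : i + 1 + j = n)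
    (hu : u < fibUp ((i + 1 : ℕ) : ℤ)) (hv : v < fibUp ((j + 1 : ℕ) : ℤ))
    (h : IsFree N (i + 1) (j + 1) u v) : digit u 0 = 0 ∨ digit (parent v) 0 = 0 := by
  rcases hN.refine_cases hij hu (parent_lt_fibUp_iff.2 hv) with h1 | h1 | h1 | h1
  · rcases eq_shift_parent v with h2 | ⟨h0, h2⟩
    · rw [← h2] at h1
      exact absurd h (not_isFree_of_eq h1.2.2)
    · exact Or.inr h0
  all_goals tauto

end step

/-- The first `j` digits of the second coordinate of the new point whose first coordinate starts
with the `n` digits of `x`: each digit is chosen so as to enter the free half of the current box. -/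
noncomputable def trace (n : ℕ) (N : ℕ → ℕ → ℕ → ℕ → ℕ) : ℕ → ℕ → ℕ
  | 0, _ => 0
  | j + 1, x =>
    open Classical in
    if IsFree N (n - j) (j + 1) (parent^[j] x) (shift (trace n N j x))
    then shift (trace n N j x) else shift (trace n N j x) + 1

section trace

variable {n i j u v x : ℕ} {N : ℕ → ℕ → ℕ → ℕ → ℕ}

theorem IsBalanced.trace_succ (hN : IsBalanced n N) (hij : i + 1 + j = n) (hx : x < fibUp n)
    (hv : trace n N j x < fibUp j)
    (h : digit (parent^[j] x) 0 = 0 ∨ digit (trace n N j x) 0 = 0) :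
    parent (trace n N (j + 1) x) = trace n N j x ∧
      IsFree N (i + 1) (j + 1) (parent^[j] x) (trace n N (j + 1) x) := by
  have hu : parent^[j] x < fibUp ((i + 1 : ℕ) : ℤ) := iterate_parent_lt_fibUp (by rwa [hij])
  obtain ⟨w, ⟨hw, hw'⟩, -⟩ := hN.exists_isFree hij hu hv h
  rw [trace, show n - j = i + 1 by lia]
  split_ifs with h1
  · exact ⟨parent_shift _, h1⟩
  · rcases parent_eq_iff.1 hw with rfl | ⟨h0, rfl⟩
    · exact absurd hw' h1
    · exact ⟨hw, hw'⟩

theorem IsBalanced.trace_mem (hN : IsBalanced n N) (hij : i + j = n) (hx : x < fibUp n) :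
    trace n N j x < fibUp j ∧ (digit (parent^[j] x) 0 = 0 ∨ digit (trace n N j x) 0 = 0) := by
  induction j generalizing i with
  | zero => exact ⟨by simp [trace, fibUp], Or.inr (digit_zero_left 0)⟩
  | succ j ih =>
    have hij' : i + 1 + j = n := by lia
    obtain ⟨h1, h2⟩ := ih hij'
    obtain ⟨h3, h4⟩ := hN.trace_succ hij' hx h1 h2
    have hu : parent^[j] x < fibUp ((i + 1 : ℕ) : ℤ) := iterate_parent_lt_fibUp (by rwa [hij'])
    have hv : trace n N (j + 1) x < fibUp ((j + 1 : ℕ) : ℤ) := by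
      rwa [← parent_lt_fibUp_iff, h3]
    refine ⟨hv, ?_⟩
    rw [Function.iterate_succ_apply']
    exact (hN.flip.digit_of_isFree (by lia) hv hu (isFree_flip.2 h4)).symm

/-- In shape `i + j = n`, the traces visit every box exactly once, except that they avoid the boxes
with last digit `1` in both coordinates. The step from `j` to `j + 1` digits is a bijection because
refining either coordinate leads to a unique free half. -/
theorem IsBalanced.existsUnique_trace (hN : IsBalanced n N) (hij : i + j = n) (hu : u < fibUp i)
    (hv : v < fibUp j) (h : digit u 0 = 0 ∨ digit v 0 = 0) :
    ∃! x, x < fibUp n ∧ parent^[j] x = u ∧ trace n N j x = v := by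
  induction j generalizing i u v with
  | zero =>
    have hv0 : v = 0 := by simpa [fibUp] using hv
    refine ⟨u, ⟨by rwa [← hij], rfl, hv0.symm⟩, fun y hy ↦ hy.2.1⟩
  | succ j ih =>
    have hij' : i + 1 + j = n := by lia
    obtain ⟨w, ⟨hw, hwf⟩, hwu⟩ :=
      hN.flip.exists_isFree (i := j) (j := i) (by lia) hv hu h.symm
    rw [isFree_flip] at hwf
    have hw1 : w < fibUp ((i + 1 : ℕ) : ℤ) := by rwa [← parent_lt_fibUp_iff, hw]
    have hpv : parent v < fibUp j := parent_lt_fibUp_iff.2 hv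
    have hd := hN.digit_of_isFree hij' hw1 hv hwf
    obtain ⟨x, ⟨hx, hx1, hx2⟩, hxu⟩ := ih hij' hw1 hpv hd
    have hstep : ∀ y < fibUp n, parent (trace n N (j + 1) y) = trace n N j y ∧
        IsFree N (i + 1) (j + 1) (parent^[j] y) (trace n N (j + 1) y) := fun y hy ↦
      hN.trace_succ hij' hy (hN.trace_mem hij' hy).1 (hN.trace_mem hij' hy).2
    refine ⟨x, ⟨hx, by rw [Function.iterate_succ_apply', hx1, hw], ?_⟩, ?_⟩
    · obtain ⟨h1, h2⟩ := hstep x hx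
      rw [hx1] at h2
      rw [hx2] at h1
      exact (hN.exists_isFree hij' hw1 hpv hd).unique ⟨h1, h2⟩ ⟨rfl, hwf⟩
    · rintro y ⟨hy, hy1, hy2⟩
      obtain ⟨h1, h2⟩ := hstep y hy
      rw [hy2] at h1 h2
      rw [Function.iterate_succ_apply'] at hy1
      exact hxu y ⟨hy, hwu _ ⟨hy1, isFree_flip.2 h2⟩, h1.symm⟩

theorem IsBalanced.trace_iterate (hN : IsBalanced n N) (hij : i + j = n) (hx : x < fibUp n) :
    parent^[i] (trace n N n x) = trace n N j x := by
  induction i generalizing j with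
  | zero => rw [← hij, zero_add]; rfl
  | succ i ih =>
    rw [Function.iterate_succ_apply', ih (j := j + 1) (by lia)]
    exact (hN.trace_succ hij hx (hN.trace_mem hij hx).1 (hN.trace_mem hij hx).2).1

/-- In shape `i + j = n + 1`, the traces visit exactly the free boxes, once each. -/
theorem IsBalanced.existsUnique_trace_of_isFree (hN : IsBalanced n N) (hij : i + 1 + j = n)
    (hu : u < fibUp ((i + 1 : ℕ) : ℤ)) (hv : v < fibUp ((j + 1 : ℕ) : ℤ))
    (h : IsFree N (i + 1) (j + 1) u v) :
    ∃! x, x < fibUp n ∧ parent^[j] x = u ∧ trace n N (j + 1) x = v := by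
  have hpv : parent v < fibUp j := parent_lt_fibUp_iff.2 hv
  have hd := hN.digit_of_isFree hij hu hv h
  have hstep : ∀ y < fibUp n, parent (trace n N (j + 1) y) = trace n N j y ∧
      IsFree N (i + 1) (j + 1) (parent^[j] y) (trace n N (j + 1) y) := fun y hy ↦
    hN.trace_succ hij hy (hN.trace_mem hij hy).1 (hN.trace_mem hij hy).2
  obtain ⟨x, ⟨hx, hx1, hx2⟩, hxu⟩ := hN.existsUnique_trace hij hu hpv hd
  refine ⟨x, ⟨hx, hx1, ?_⟩, ?_⟩
  · obtain ⟨h1, h2⟩ := hstep x hx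
    rw [hx1] at h2
    rw [hx2] at h1
    exact (hN.exists_isFree hij hu hpv hd).unique ⟨h1, h2⟩ ⟨rfl, h⟩
  · rintro y ⟨hy, hy1, hy2⟩
    refine hxu y ⟨hy, hy1, ?_⟩
    rw [← (hstep y hy).1, hy2]

theorem IsBalanced.isFree_trace (hN : IsBalanced n N) (hij : i + 1 + j = n) (hx : x < fibUp n) :
    IsFree N (i + 1) (j + 1) (parent^[j] x) (trace n N (j + 1) x) :=
  (hN.trace_succ hij hx (hN.trace_mem hij hx).1 (hN.trace_mem hij hx).2).2

end trace

/-! ### Counting points in boxes -/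

/-- The number of points of `P` in the box with index `(u, v)` in shape `(i, j)`. -/
noncomputable def boxCount (P : Set (Fin 2 → ℝ)) (i j u v : ℕ) : ℕ :=
  (P ∩ elemBox ![i, j] ![u, v]).ncard

/-- The number of points of `P` whose coordinate `c` lies in the elementary `k`-interval `a`. -/
noncomputable def lineCount (P : Set (Fin 2 → ℝ)) (c : Fin 2) (k a : ℕ) : ℕ :=
  (P ∩ {x | x c ∈ elemIco k a}).ncard

theorem mem_elemBox_two {i j u v : ℕ} {x : Fin 2 → ℝ} :
    x ∈ elemBox ![i, j] ![u, v] ↔ x 0 ∈ elemIco i u ∧ x 1 ∈ elemIco j v := by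
  simp [elemBox, Fin.forall_fin_two]

theorem ncard_inter_split {α : Type*} {P A B C : Set α} (hP : P.Finite) (h : A = B ∪ C)
    (hd : Disjoint B C) : (P ∩ A).ncard = (P ∩ B).ncard + (P ∩ C).ncard := by
  rw [h, Set.inter_union_distrib_left]
  exact Set.ncard_union_eq (hd.mono Set.inter_subset_right Set.inter_subset_right)
    (hP.inter_of_left _) (hP.inter_of_left _)

theorem disjoint_elemIco_succ (k a : ℕ) : Disjoint (elemIco k a) (elemIco k (a + 1)) :=
  Set.disjoint_left.2 fun _ h1 h2 ↦ by have := elemIco_disjoint h1 h2; lia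

theorem isBoxCount_boxCount {P : Set (Fin 2 → ℝ)} (hP : P.Finite) : IsBoxCount (boxCount P) where
  fst_zero i j u v h := by
    refine ncard_inter_split hP ?_ ?_
    · ext x
      simp only [Set.mem_union, mem_elemBox_two, elemIco_split h]
      tauto
    · refine Set.disjoint_left.2 fun x h1 h2 ↦ ?_
      rw [mem_elemBox_two] at h1 h2
      exact Set.disjoint_left.1 (disjoint_elemIco_succ _ _) h1.1 h2.1
  fst_one i j u v h := by
    unfold boxCount
    congr 2; ext x
    rw [mem_elemBox_two, mem_elemBox_two, elemIco_shift_of_digit_one h]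
  snd_zero i j u v h := by
    refine ncard_inter_split hP ?_ ?_
    · ext x
      simp only [Set.mem_union, mem_elemBox_two, elemIco_split h]
      tauto
    · refine Set.disjoint_left.2 fun x h1 h2 ↦ ?_
      rw [mem_elemBox_two] at h1 h2
      exact Set.disjoint_left.1 (disjoint_elemIco_succ _ _) h1.2 h2.2
  snd_one i j u v h := by
    unfold boxCount
    congr 2; ext x
    rw [mem_elemBox_two, mem_elemBox_two, elemIco_shift_of_digit_one h]

theorem lineCount_split {P : Set (Fin 2 → ℝ)} (hP : P.Finite) (c : Fin 2) (k : ℕ) {a : ℕ}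
    (h : digit a 0 = 0) :
    lineCount P c k a = lineCount P c (k + 1) (shift a) + lineCount P c (k + 1) (shift a + 1) := by
  refine ncard_inter_split hP ?_ ?_
  · ext x; simp only [Set.mem_union, Set.mem_ofPred_eq, elemIco_split h]
  · exact Set.disjoint_left.2 fun x h1 h2 ↦
      Set.disjoint_left.1 (disjoint_elemIco_succ _ _) h1 h2

theorem lineCount_shift_of_digit_one {P : Set (Fin 2 → ℝ)} (c : Fin 2) (k : ℕ) {a : ℕ}
    (h : digit a 0 = 1) : lineCount P c (k + 1) (shift a) = lineCount P c k a := by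
  rw [lineCount, lineCount, elemIco_shift_of_digit_one h]

theorem boxCount_union {P Q : Set (Fin 2 → ℝ)} (hP : P.Finite) (hQ : Q.Finite)
    (h : Disjoint P Q) (i j u v : ℕ) :
    boxCount (P ∪ Q) i j u v = boxCount P i j u v + boxCount Q i j u v := by
  rw [boxCount, Set.union_inter_distrib_right]
  exact Set.ncard_union_eq (h.mono Set.inter_subset_left Set.inter_subset_left)
    (hP.inter_of_left _) (hQ.inter_of_left _)

theorem lineCount_union {P Q : Set (Fin 2 → ℝ)} (hP : P.Finite) (hQ : Q.Finite)
    (h : Disjoint P Q) (c : Fin 2) (k a : ℕ) :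
    lineCount (P ∪ Q) c k a = lineCount P c k a + lineCount Q c k a := by
  rw [lineCount, Set.union_inter_distrib_right]
  exact Set.ncard_union_eq (h.mono Set.inter_subset_left Set.inter_subset_left)
    (hP.inter_of_left _) (hQ.inter_of_left _)

theorem boxCount_zero_right {P : Set (Fin 2 → ℝ)} (hP : ∀ x ∈ P, ∀ j, x j ∈ Set.Ico (0 : ℝ) 1)
    (k a : ℕ) : boxCount P k 0 a 0 = lineCount P 0 k a := by
  unfold boxCount lineCount
  congr 1; ext x
  simp only [Set.mem_inter_iff, mem_elemBox_two, elemIco_zero_zero, Set.mem_ofPred_eq]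
  exact ⟨fun h ↦ ⟨h.1, h.2.1⟩, fun h ↦ ⟨h.1, h.2, hP x h.1 1⟩⟩

theorem boxCount_zero_left {P : Set (Fin 2 → ℝ)} (hP : ∀ x ∈ P, ∀ j, x j ∈ Set.Ico (0 : ℝ) 1)
    (k a : ℕ) : boxCount P 0 k 0 a = lineCount P 1 k a := by
  unfold boxCount lineCount
  congr 1; ext x
  simp only [Set.mem_inter_iff, mem_elemBox_two, elemIco_zero_zero, Set.mem_ofPred_eq]
  exact ⟨fun h ↦ ⟨h.1, h.2.2⟩, fun h ↦ ⟨h.1, hP x h.1 0, h.2⟩⟩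

/-- The box count `N` has the values that strong equidistribution in shape `(i, j)` of a set with
`F^M` points demands. -/
def IsUniform (M : ℤ) (N : ℕ → ℕ → ℕ → ℕ → ℕ) (i j : ℕ) : Prop :=
  ∀ u < fibUp i, ∀ v < fibUp j,
    N i j u v = fibUp (M - ((i + digit u 0 + (j + digit v 0) : ℕ) : ℤ))

theorem isStronglyEquidistributed_iff {M : ℤ} {k : Fin 2 → ℕ} {P : Set (Fin 2 → ℝ)} :
    IsStronglyEquidistributed M k P ↔
      IsPointSet M P ∧ IsUniform M (boxCount P) (k 0) (k 1) := by
  have hk : k = ![k 0, k 1] := by ext c; fin_cases c <;> rfl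
  refine and_congr_right fun _ ↦ ⟨fun h u hu v hv ↦ ?_, fun h a ha ↦ ?_⟩
  · have := h ![u, v] (Fin.forall_fin_two.2 ⟨hu, hv⟩)
    rw [boxCount, ← hk, this]
    simp [boxExp, Fin.sum_univ_two]
  · have ha' : a = ![a 0, a 1] := by ext c; fin_cases c <;> rfl
    have := h (a 0) (ha 0) (a 1) (ha 1)
    rw [boxCount, ← hk, ← ha'] at this
    rw [this]
    simp [boxExp, Fin.sum_univ_two]

/-- Equidistribution is inherited by coarser boxes, as long as their expected number of points is
given by an exponent for which the Fibonacci recurrence holds. -/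
theorem IsUniform.of_succ {M : ℤ} {N : ℕ → ℕ → ℕ → ℕ → ℕ} {i j : ℕ} (hN : IsBoxCount N)
    (h : IsUniform M N (i + 1) j) (hM : ∀ v < fibUp j, ((i + (j + digit v 0) : ℕ) : ℤ) ≤ M) :
    IsUniform M N i j := by
  intro u hu v hv
  rcases digit_eq_zero_or_one u 0 with h0 | h0
  · rw [hN.fst_zero _ _ _ _ h0, h _ (shift_lt_fibUp_iff.2 hu) _ hv,
      h _ ((shift_add_one_lt_fibUp_iff h0).2 hu) _ hv, digit_shift_zero,
      digit_shift_add_one_zero h0, h0, add_zero]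
    rw [fibUp_eq_add (e := M - ((i + 0 + (j + digit v 0) : ℕ) : ℤ)) (by have := hM v hv; lia)]
    congr 2 <;> push_cast <;> ring
  · rw [hN.fst_one _ _ _ _ h0, h _ (shift_lt_fibUp_iff.2 hu) _ hv, digit_shift_zero, h0]

theorem rho_two (k : Fin 2 → ℕ) :
    rho k = k 0 + k 1 + ((if k 0 ≠ 0 then 1 else 0) + (if k 1 ≠ 0 then 1 else 0)) := by
  rw [rho, Finset.card_filter, Fin.sum_univ_two, Fin.sum_univ_two]

theorem exists_prime_index {k a : ℕ} (ha : a < fibUp k) :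
    ∃ k' a' : ℕ, k' ≤ k ∧ a' < fibUp k' ∧ digit a' 1 = 0 ∧ elemIco k' a' = elemIco k a ∧
      k' + digit a' 0 = k + digit a 0 := by
  rcases digit_eq_zero_or_one a 1 with h1 | h1
  · exact ⟨k, a, le_rfl, ha, h1, rfl, rfl⟩
  · obtain ⟨p, rfl | ⟨hp, rfl⟩⟩ := exists_shift a
    · rw [digit_shift_one] at h1
      cases k with
      | zero =>
        have h0 : shift p = shift 0 := by
          have : shift p < 1 := by simpa [fibUp] using ha
          rw [shift_zero]; lia
        rw [shift_strictMono.injective h0, digit_zero_left] at h1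
        lia
      | succ k =>
        refine ⟨k, p, Nat.le_succ k, shift_lt_fibUp_iff.1 ha, ?_,
          (elemIco_shift_of_digit_one h1).symm, by rw [digit_shift_zero, h1]⟩
        obtain ⟨q, rfl | ⟨hq, rfl⟩⟩ := exists_shift p
        · rw [digit_shift_zero] at h1; lia
        · exact digit_shift_add_one_one hq
    · rw [digit_shift_add_one_one hp] at h1; lia

/-- A net is even strongly equidistributed: an interval that is not prime coincides with a prime one
whose index has one digit less. -/
theorem IsNet.isStronglyEquidistributed {s t : ℕ} {M : ℤ} {P : Set (Fin s → ℝ)} (h : IsNet t M P)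
    {k : Fin s → ℕ} (hk : (rho k : ℤ) ≤ M + 2 - t) : IsStronglyEquidistributed M k P := by
  refine ⟨h.1, fun a ha ↦ ?_⟩
  choose k' a' h1 h2 h3 h4 h5 using fun j ↦ exists_prime_index (ha j)
  have hrho : rho k' ≤ rho k := by
    refine Nat.add_le_add (Finset.sum_le_sum fun j _ ↦ h1 j) (Finset.card_le_card ?_)
    intro j hj
    simp only [Finset.mem_filter, Finset.mem_univ, true_and] at hj ⊢
    have := h1 j; lia
  have := (h.2 k' (by lia)).2 a' fun j ↦ ⟨h2 j, h3 j⟩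
  have hb : elemBox k' a' = elemBox k a := by ext x; simp [elemBox, h4]
  have he : boxExp k' a' = boxExp k a := Finset.sum_congr rfl fun j _ ↦ h5 j
  rwa [hb, he] at this

theorem IsStronglyEquidistributed.isEquidistributed {s : ℕ} {M : ℤ} {P : Set (Fin s → ℝ)}
    {k : Fin s → ℕ} (h : IsStronglyEquidistributed M k P) : IsEquidistributed M k P :=
  ⟨h.1, fun a ha ↦ h.2 a fun j ↦ (ha j).1⟩

theorem isNet_of_isUniform {t : ℕ} {M : ℤ} {P : Set (Fin 2 → ℝ)} (hP : IsPointSet M P)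
    (h : ∀ k : Fin 2 → ℕ, (rho k : ℤ) ≤ M + 2 - t → IsUniform M (boxCount P) (k 0) (k 1)) :
    IsNet t M P :=
  ⟨hP, fun k hk ↦
    (isStronglyEquidistributed_iff.2 ⟨hP, h k hk⟩).isEquidistributed⟩

theorem HasDigits.nthDigitZero {s n : ℕ} {P : Set (Fin s → ℝ)} (h : HasDigits n P) :
    NthDigitZero (n + 1) P := by
  intro x hx j a _ ha hxa
  obtain ⟨b, -, hb⟩ := h x hx j
  have h1 := left_mem_elemIco (n + 1) (shift b)
  rw [whole_shift_div, ← hb] at h1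
  rw [elemIco_disjoint hxa h1, digit_shift_zero] at ha
  lia

theorem HasDigits.succ {s n : ℕ} {P : Set (Fin s → ℝ)} (h : HasDigits n P) :
    HasDigits (n + 1) P := by
  intro x hx j
  obtain ⟨b, hb, hb'⟩ := h x hx j
  exact ⟨shift b, shift_lt_fibUp_iff.2 hb, by rw [whole_shift_div, hb']⟩

theorem NthDigitZero.lineCount_eq_zero {k a : ℕ} {P : Set (Fin 2 → ℝ)} (h : NthDigitZero k P)
    (c : Fin 2) (ha : a < fibUp k) (ha' : digit a 0 = 1) : lineCount P c k a = 0 := by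
  have : P ∩ {x | x c ∈ elemIco k a} = ∅ :=
    Set.eq_empty_iff_forall_notMem.2 fun x hx ↦ h x hx.1 c a ha ha' hx.2
  rw [lineCount, this, Set.ncard_empty]

theorem NthDigitZero.lineCount_shift {k a : ℕ} {P : Set (Fin 2 → ℝ)} (h : NthDigitZero (k + 1) P)
    (hP : P.Finite) (c : Fin 2) (ha : a < fibUp k) :
    lineCount P c (k + 1) (shift a) = lineCount P c k a := by
  rcases digit_eq_zero_or_one a 0 with h0 | h0
  · rw [lineCount_split hP c k h0, h.lineCount_eq_zero c ((shift_add_one_lt_fibUp_iff h0).2 ha)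
      (digit_shift_add_one_zero h0), add_zero]
  · exact lineCount_shift_of_digit_one c k h0

theorem ncard_image_inter_eq_one {α β : Type*} {f : α → β} {s : Set α} {B : Set β}
    (h : ∃! x, x ∈ s ∧ f x ∈ B) : (f '' s ∩ B).ncard = 1 := by
  obtain ⟨x, ⟨hx, hxB⟩, hu⟩ := h
  rw [Set.ncard_eq_one]
  refine ⟨f x, Set.Subset.antisymm ?_ ?_⟩
  · rintro _ ⟨⟨y, hy, rfl⟩, hyB⟩
    rw [hu y ⟨hy, hyB⟩]; rfl
  · rintro _ rfl; exact ⟨⟨x, hx, rfl⟩, hxB⟩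

theorem ncard_image_inter_eq_zero {α β : Type*} {f : α → β} {s : Set α} {B : Set β}
    (h : ∀ x ∈ s, f x ∉ B) : (f '' s ∩ B).ncard = 0 := by
  have : f '' s ∩ B = ∅ := by
    refine Set.eq_empty_iff_forall_notMem.2 ?_
    rintro _ ⟨⟨y, hy, rfl⟩, hyB⟩
    exact h y hy hyB
  rw [this, Set.ncard_empty]

/-! ### The complementary net -/

/-- What the points `P` that are to be added to `S` have to satisfy: they complete the box counts
of `S` to the capacities in the shapes with `i + j = m` and both entries positive, they are
equidistributed in the shapes with `i + j = m - 1`, and in every coordinate they meet exactly the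
elementary `(m + 1)`-intervals with last digit `1`, once each. -/
structure IsComplement (m : ℕ) (S P : Set (Fin 2 → ℝ)) : Prop where
  isPointSet : IsPointSet ((m : ℤ) - 1) P
  hasDigits : HasDigits (m + 1) P
  lineCount_eq : ∀ c, ∀ b < fibUp ((m + 1 : ℕ) : ℤ), lineCount P c (m + 1) b = digit b 0
  isUniform : ∀ i j, i + j + 1 = m → IsUniform ((m : ℤ) - 1) (boxCount P) i j
  boxCount_add : ∀ i j, i + j + 2 = m → ∀ u < fibUp ((i + 1 : ℕ) : ℤ),
    ∀ v < fibUp ((j + 1 : ℕ) : ℤ),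
    boxCount S (i + 1) (j + 1) u v + boxCount P (i + 1) (j + 1) u v = capacity u v

/-- For `m = 0` the single new point is `(φ⁻¹, φ⁻¹)`. -/
theorem isComplement_zero (S : Set (Fin 2 → ℝ)) :
    IsComplement 0 S {fun _ ↦ whole 1 / Real.goldenRatio ^ 1} := by
  have hmem := left_mem_elemIco 1 1
  have h1 : (1 : ℕ) < fibUp ((1 : ℕ) : ℤ) := by decide
  have hd : digit 1 0 = 1 := by
    have := digit_shift_add_one_zero (digit_zero_left 0)
    rwa [shift_zero] at this
  refine ⟨⟨?_, Set.finite_singleton _, ?_⟩, ?_, ?_, fun i j h ↦ by lia, fun i j h ↦ by lia⟩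
  · rintro _ rfl _
    exact elemIco_subset_Ico h1 hmem
  · rw [Set.ncard_singleton]; rfl
  · rintro _ rfl _
    exact ⟨1, h1, rfl⟩
  · intro c b hb
    have hb2 : b < 2 := hb
    rw [lineCount]
    interval_cases b
    · rw [digit_zero_left, Set.ncard_eq_zero ((Set.finite_singleton _).inter_of_left _)]
      refine Set.eq_empty_iff_forall_notMem.2 ?_
      rintro _ ⟨rfl, h⟩
      exact absurd (elemIco_disjoint h hmem) (by lia)
    · rw [hd, Set.inter_eq_left.2, Set.ncard_singleton]
      rintro _ rfl
      exact hmem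

/-- The left end point of the interval that arises from the `n`-interval with index `y` by appending
the digits `01`. -/
noncomputable def endpoint (n y : ℕ) : ℝ :=
  whole (shift (shift y) + 1) / Real.goldenRatio ^ (n + 2)

theorem endpoint_mem (n y : ℕ) : endpoint n y ∈ elemIco (n + 2) (shift (shift y) + 1) :=
  left_mem_elemIco _ _

theorem endpoint_mem_iff {n i j y u : ℕ} (hij : i + j = n) :
    endpoint n y ∈ elemIco i u ↔ parent^[j] y = u := by
  subst hij
  rw [mem_elemIco_iff_iterate_parent (j := j + 2) (endpoint_mem (i + j) y),
    Function.iterate_add_apply]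
  simp [parent_shift_add_one (digit_shift_zero y), parent_shift]

theorem endpoint_mem_succ_succ_iff {n y b : ℕ} :
    endpoint n y ∈ elemIco (n + 2) b ↔ b = shift (shift y) + 1 :=
  ⟨fun h ↦ elemIco_disjoint h (endpoint_mem n y), fun h ↦ h ▸ endpoint_mem n y⟩

/-- A number with last digit `1` is obtained by appending the digits `01` to a shorter one. -/
theorem exists_eq_shift_shift_add_one {n b : ℕ} (hb : b < fibUp ((n + 2 : ℕ) : ℤ))
    (h : digit b 0 = 1) : ∃ y < fibUp n, b = shift (shift y) + 1 := by
  obtain ⟨e, rfl | ⟨he, rfl⟩⟩ := exists_shift b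
  · rw [digit_shift_zero] at h; lia
  · obtain ⟨y, rfl | ⟨hy, rfl⟩⟩ := exists_shift e
    · exact ⟨y, shift_lt_fibUp_iff.1 ((shift_add_one_lt_fibUp_iff he).1 hb), rfl⟩
    · rw [digit_shift_add_one_zero hy] at he; lia

theorem shift_shift_add_one_inj {x y : ℕ} :
    shift (shift x) + 1 = shift (shift y) + 1 ↔ x = y := by
  rw [Nat.add_right_cancel_iff, shift_strictMono.injective.eq_iff,
    shift_strictMono.injective.eq_iff]

theorem IsBalanced.exists_isComplement {n : ℕ} {S : Set (Fin 2 → ℝ)}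
    (hN : IsBalanced n (boxCount S)) : ∃ P, IsComplement (n + 1) S P := by
  set g := trace n (boxCount S) n with hg
  set f : ℕ → Fin 2 → ℝ := fun x ↦ ![endpoint n x, endpoint n (g x)] with hf
  have hgn : ∀ x < fibUp n, g x < fibUp n := fun x hx ↦ (hN.trace_mem (zero_add n) hx).1
  have hf0 : ∀ x, f x 0 = endpoint n x := fun _ ↦ rfl
  have hf1 : ∀ x, f x 1 = endpoint n (g x) := fun _ ↦ rfl
  have hlt : ∀ y < fibUp n, shift (shift y) + 1 < fibUp ((n + 2 : ℕ) : ℤ) := fun y hy ↦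
    (shift_add_one_lt_fibUp_iff (k := n + 1) (digit_shift_zero y)).2 (shift_lt_fibUp_iff.2 hy)
  -- In shape `i + j = n`, a new point is found by its traces.
  have hbox : ∀ i j u v x, i + j = n → x < fibUp n →
      (f x ∈ elemBox ![i, j] ![u, v] ↔ parent^[j] x = u ∧ trace n (boxCount S) j x = v) := by
    intro i j u v x hij hx
    rw [mem_elemBox_two, hf0, hf1, endpoint_mem_iff hij, endpoint_mem_iff (j := i) (by lia), hg,
      hN.trace_iterate hij hx]
  have hbox' : ∀ i j u v x, i + 1 + j = n → x < fibUp n →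
      (f x ∈ elemBox ![i + 1, j + 1] ![u, v] ↔
        parent^[j] x = u ∧ trace n (boxCount S) (j + 1) x = v) := by
    intro i j u v x hij hx
    rw [mem_elemBox_two, hf0, hf1, endpoint_mem_iff hij, endpoint_mem_iff (j := i) (by lia), hg,
      hN.trace_iterate (j := j + 1) (by lia) hx]
  have hinj : Set.InjOn f (Set.Iio (fibUp n)) := by
    intro x _ y _ hxy
    have h1 : endpoint n y ∈ elemIco (n + 2) (shift (shift x) + 1) := by
      rw [← hf0 y, ← hxy]; exact endpoint_mem n x
    exact shift_shift_add_one_inj.1 (endpoint_mem_succ_succ_iff.1 h1)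
  refine ⟨f '' Set.Iio (fibUp n), ⟨?_, (Set.finite_Iio _).image _, ?_⟩, ?_, ?_, ?_, ?_⟩
  · rintro _ ⟨x, hx, rfl⟩
    refine Fin.forall_fin_two.2 ⟨?_, ?_⟩
    · exact elemIco_subset_Ico (hlt x hx) (endpoint_mem n x)
    · exact elemIco_subset_Ico (hlt _ (hgn x hx)) (endpoint_mem n (g x))
  · rw [hinj.ncard_image]
    simp
  · rintro _ ⟨x, hx, rfl⟩
    exact Fin.forall_fin_two.2 ⟨⟨_, hlt x hx, rfl⟩, ⟨_, hlt _ (hgn x hx), rfl⟩⟩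
  · intro c b hb
    have hc : ∀ x, f x c = endpoint n (if c = 0 then x else g x) := by
      intro x; fin_cases c <;> rfl
    rcases digit_eq_zero_or_one b 0 with h0 | h0
    · rw [h0]
      refine ncard_image_inter_eq_zero fun x _ hxb ↦ ?_
      rw [Set.mem_ofPred_eq, hc] at hxb
      rw [endpoint_mem_succ_succ_iff.1 hxb, digit_shift_add_one_zero (digit_shift_zero _)] at h0
      lia
    · obtain ⟨y, hy, rfl⟩ := exists_eq_shift_shift_add_one hb h0
      rw [h0]
      refine ncard_image_inter_eq_one ?_
      simp only [Set.mem_ofPred_eq, hc, endpoint_mem_succ_succ_iff, shift_shift_add_one_inj,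
        Set.mem_Iio]
      fin_cases c
      · exact ⟨y, ⟨hy, rfl⟩, fun x hx ↦ hx.2.symm⟩
      · obtain ⟨x, ⟨h1, -, h2⟩, h3⟩ := hN.existsUnique_trace (u := 0) (zero_add n)
          (by simp [fibUp]) hy (Or.inl (digit_zero_left 0))
        refine ⟨x, ⟨h1, h2.symm⟩, fun x' hx' ↦ h3 x' ⟨hx'.1, ?_, hx'.2.symm⟩⟩
        have : parent^[n] x' < fibUp ((0 : ℕ) : ℤ) :=
          iterate_parent_lt_fibUp (by rw [zero_add]; exact hx'.1)
        simpa [fibUp] using this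
  · intro i j hij u hu v hv
    have hij' : i + j = n := by lia
    have hexp : (((n + 1 : ℕ) : ℤ) - 1 - ((i + digit u 0 + (j + digit v 0) : ℕ) : ℤ)) =
        -(digit u 0 + digit v 0 : ℕ) := by lia
    rw [hexp]
    by_cases h : digit u 0 = 0 ∨ digit v 0 = 0
    · have h1 : fibUp (-(digit u 0 + digit v 0 : ℕ)) = 1 := by
        rcases digit_eq_zero_or_one u 0 with h2 | h2 <;>
        rcases digit_eq_zero_or_one v 0 with h3 | h3 <;>
        rw [h2, h3] at h ⊢ <;> first | rfl | lia
      rw [h1]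
      refine ncard_image_inter_eq_one ?_
      obtain ⟨x, ⟨hx, hx'⟩, hu⟩ := hN.existsUnique_trace hij' hu hv h
      exact ⟨x, ⟨hx, (hbox i j u v x hij' hx).2 hx'⟩,
        fun y hy ↦ hu y ⟨hy.1, (hbox i j u v y hij' hy.1).1 hy.2⟩⟩
    · have h2 : digit u 0 = 1 := (digit_eq_zero_or_one u 0).resolve_left fun h' ↦ h (Or.inl h')
      have h3 : digit v 0 = 1 := (digit_eq_zero_or_one v 0).resolve_left fun h' ↦ h (Or.inr h')
      rw [h2, h3]
      refine ncard_image_inter_eq_zero fun x hx hxb ↦ h ?_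
      obtain ⟨rfl, rfl⟩ := (hbox i j u v x hij' hx).1 hxb
      exact (hN.trace_mem hij' hx).2
  · intro i j hij u hu v hv
    have hij' : i + 1 + j = n := by lia
    rcases hN.isFree_or_eq hij' hu hv with h | h
    · rw [← h]
      congr 1
      refine ncard_image_inter_eq_one ?_
      obtain ⟨x, ⟨hx, hx'⟩, hu⟩ := hN.existsUnique_trace_of_isFree hij' hu hv h
      exact ⟨x, ⟨hx, (hbox' i j u v x hij' hx).2 hx'⟩,
        fun y hy ↦ hu y ⟨hy.1, (hbox' i j u v y hij' hy.1).1 hy.2⟩⟩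
    · rw [h, Nat.add_eq_left]
      refine ncard_image_inter_eq_zero fun x hx hxb ↦ ?_
      obtain ⟨rfl, rfl⟩ := (hbox' i j u v x hij' hx).1 hxb
      exact not_isFree_of_eq h (hN.isFree_trace hij' hx)

/-! ### Extension of nets -/

theorem isBalanced_of_isNet {n : ℕ} {S : Set (Fin 2 → ℝ)} (h : IsNet 1 ((n + 1 : ℕ) : ℤ) S) :
    IsBalanced n (boxCount S) where
  toIsBoxCount := isBoxCount_boxCount h.1.2.1
  eq_capacity i j u v hij hu hv := by
    have hr : (rho ![i, j] : ℤ) ≤ ((n + 1 : ℕ) : ℤ) + 2 - (1 : ℕ) := by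
      rw [rho_two]
      simp only [Matrix.cons_val_zero, Matrix.cons_val_one]
      split_ifs <;> push_cast <;> lia
    have := (isStronglyEquidistributed_iff.1 (h.isStronglyEquidistributed hr)).2 u hu v hv
    simp only [Matrix.cons_val_zero, Matrix.cons_val_one] at this
    rw [this, capacity]
    congr 1
    lia

theorem exists_isComplement {m : ℕ} {S : Set (Fin 2 → ℝ)} (h : IsNet 1 (m : ℤ) S) :
    ∃ P, IsComplement m S P := by
  cases m with
  | zero => exact ⟨_, isComplement_zero S⟩
  | succ n => exact (isBalanced_of_isNet h).exists_isComplement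

/-- Strong equidistribution in the shape `(k, 0)` or `(0, k)`, as a count along a coordinate. -/
def IsLineUniform (M : ℤ) (P : Set (Fin 2 → ℝ)) (k : ℕ) : Prop :=
  ∀ c, ∀ b < fibUp k, lineCount P c k b = fibUp (M - ((k + digit b 0 : ℕ) : ℤ))

theorem isUniform_zero_right_iff {M : ℤ} {P : Set (Fin 2 → ℝ)}
    (hP : ∀ x ∈ P, ∀ j, x j ∈ Set.Ico (0 : ℝ) 1) (k : ℕ) :
    IsUniform M (boxCount P) k 0 ↔
      ∀ b < fibUp k, lineCount P 0 k b = fibUp (M - ((k + digit b 0 : ℕ) : ℤ)) := by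
  have h0 : ∀ v, v < fibUp ((0 : ℕ) : ℤ) ↔ v = 0 := fun v ↦ by simp [fibUp]
  simp only [IsUniform, h0, forall_eq, digit_zero_left, boxCount_zero_right hP, add_zero, zero_add]

theorem isUniform_zero_left_iff {M : ℤ} {P : Set (Fin 2 → ℝ)}
    (hP : ∀ x ∈ P, ∀ j, x j ∈ Set.Ico (0 : ℝ) 1) (k : ℕ) :
    IsUniform M (boxCount P) 0 k ↔
      ∀ b < fibUp k, lineCount P 1 k b = fibUp (M - ((k + digit b 0 : ℕ) : ℤ)) := by
  have h0 : ∀ v, v < fibUp ((0 : ℕ) : ℤ) ↔ v = 0 := fun v ↦ by simp [fibUp]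
  simp only [IsUniform, h0, forall_eq, digit_zero_left, boxCount_zero_left hP, zero_add]

theorem isLineUniform_iff {M : ℤ} {P : Set (Fin 2 → ℝ)}
    (hP : ∀ x ∈ P, ∀ j, x j ∈ Set.Ico (0 : ℝ) 1) (k : ℕ) :
    IsLineUniform M P k ↔
      IsUniform M (boxCount P) k 0 ∧ IsUniform M (boxCount P) 0 k := by
  rw [isUniform_zero_right_iff hP, isUniform_zero_left_iff hP]
  exact Fin.forall_fin_two

theorem IsLineUniform.of_le {M : ℤ} {P : Set (Fin 2 → ℝ)} (hP : P.Finite) {k l : ℕ} (hkl : k ≤ l)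
    (hl : (l : ℤ) ≤ M + 1) (h : IsLineUniform M P l) : IsLineUniform M P k := by
  induction l, hkl using Nat.le_induction with
  | base => exact h
  | succ l hkl ih =>
    refine ih (by lia) fun c b hb ↦ ?_
    rcases digit_eq_zero_or_one b 0 with h0 | h0
    · rw [lineCount_split hP c l h0, h c _ (shift_lt_fibUp_iff.2 hb),
        h c _ ((shift_add_one_lt_fibUp_iff h0).2 hb), digit_shift_zero,
        digit_shift_add_one_zero h0, h0, fibUp_eq_add (e := M - ((l + 0 : ℕ) : ℤ)) (by lia)]
      congr 2 <;> push_cast <;> ring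
    · rw [← lineCount_shift_of_digit_one c l h0, h c _ (shift_lt_fibUp_iff.2 hb),
        digit_shift_zero, h0]

section complement

variable {m : ℕ} {S P : Set (Fin 2 → ℝ)}

theorem IsComplement.isLineUniform (h : IsComplement m S P) :
    IsLineUniform ((m : ℤ) - 1) P m := by
  intro c b hb
  rcases digit_eq_zero_or_one b 0 with h0 | h0
  · rw [lineCount_split h.isPointSet.2.1 c m h0, h.lineCount_eq c _ (shift_lt_fibUp_iff.2 hb),
      h.lineCount_eq c _ ((shift_add_one_lt_fibUp_iff h0).2 hb), digit_shift_zero,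
      digit_shift_add_one_zero h0, h0,
      show (m : ℤ) - 1 - ((m + 0 : ℕ) : ℤ) = -1 by lia]
    rfl
  · rw [← lineCount_shift_of_digit_one c m h0, h.lineCount_eq c _ (shift_lt_fibUp_iff.2 hb),
      digit_shift_zero, h0, show (m : ℤ) - 1 - ((m + 1 : ℕ) : ℤ) = -2 by lia]
    rfl

theorem IsComplement.isUniform_of_lt (h : IsComplement m S P) {i j : ℕ} (hij : i + j < m) :
    IsUniform ((m : ℤ) - 1) (boxCount P) i j := by
  obtain ⟨d, hd⟩ : ∃ d, i + j + d + 1 = m := ⟨m - (i + j + 1), by lia⟩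
  induction d generalizing i with
  | zero => exact h.isUniform i j hd
  | succ d ih =>
    refine (ih (i := i + 1) (by lia) (by lia)).of_succ (isBoxCount_boxCount h.isPointSet.2.1) ?_
    intro v _
    rcases digit_eq_zero_or_one v 0 with h0 | h0 <;> rw [h0] <;> lia

theorem IsComplement.isNet (h : IsComplement m S P) : IsNet 0 ((m : ℤ) - 1) P := by
  refine isNet_of_isUniform h.isPointSet fun k hk ↦ ?_
  by_cases hlt : k 0 + k 1 < m
  · exact h.isUniform_of_lt hlt
  -- The only other shapes are `(m, 0)` and `(0, m)`.
  · have hl := (isLineUniform_iff h.isPointSet.1 m).1 h.isLineUniform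
    have : (k 0 = m ∧ k 1 = 0) ∨ (k 0 = 0 ∧ k 1 = m) := by
      rw [rho_two] at hk
      push_cast at hk
      split_ifs at hk <;> lia
    rcases this with ⟨h0, h1⟩ | ⟨h0, h1⟩ <;> rw [h0, h1]
    exacts [hl.1, hl.2]

theorem isLineUniform_of_isStronglyEquidistributed {M : ℤ} {k : ℕ} {Q : Set (Fin 2 → ℝ)}
    (h0 : IsStronglyEquidistributed M ![k, 0] Q) (h1 : IsStronglyEquidistributed M ![0, k] Q) :
    IsLineUniform M Q k :=
  (isLineUniform_iff h0.1.1 k).2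
    ⟨(isStronglyEquidistributed_iff.1 h0).2, (isStronglyEquidistributed_iff.1 h1).2⟩

theorem IsComplement.disjoint (h : IsComplement m S P) (hS : IsPointSet (m : ℤ) S)
    (hl : IsLineUniform (m : ℤ) S (m + 1)) : Disjoint S P := by
  refine Set.disjoint_left.2 fun x hxS hxP ↦ ?_
  obtain ⟨b, hb, hxb⟩ := exists_mem_elemIco (m + 1) (hS.1 x hxS 0)
  have pos : ∀ Q : Set (Fin 2 → ℝ), Q.Finite → x ∈ Q → 0 < lineCount Q 0 (m + 1) b :=
    fun Q hQ hx ↦ (Set.ncard_pos (hQ.inter_of_left _)).2 ⟨x, hx, hxb⟩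
  have h1 := pos S hS.2.1 hxS
  have h2 := pos P h.isPointSet.2.1 hxP
  rw [h.lineCount_eq 0 b hb] at h2
  have h3 : digit b 0 = 1 := by rcases digit_eq_zero_or_one b 0 with h | h <;> lia
  rw [hl 0 b hb, h3, show (m : ℤ) - ((m + 1 + 1 : ℕ) : ℤ) = -2 by lia, fibUp_neg_two] at h1
  lia

theorem IsComplement.isPointSet_union (h : IsComplement m S P) (hS : IsPointSet (m : ℤ) S)
    (hd : Disjoint S P) : IsPointSet ((m : ℤ) + 1) (S ∪ P) := by
  refine ⟨fun x hx ↦ hx.elim (hS.1 x) (h.isPointSet.1 x), hS.2.1.union h.isPointSet.2.1, ?_⟩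
  rw [Set.ncard_union_eq hd hS.2.1 h.isPointSet.2.1, hS.2.2, h.isPointSet.2.2,
    fibUp_eq_add (e := (m : ℤ) + 1) (by lia)]
  congr 2 <;> ring

/-- Refining the elementary `(m + 1)`-intervals by another digit `0`, those that meet `S` and those
that meet `P` together account for all `(m + 2)`-intervals with last digit `0`. -/
theorem IsComplement.isLineUniform_union (h : IsComplement m S P) (hS : IsPointSet (m : ℤ) S)
    (hl : IsLineUniform (m : ℤ) S (m + 1)) (hz : NthDigitZero (m + 2) S) :
    IsLineUniform ((m : ℤ) + 1) (S ∪ P) (m + 2) := by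
  have hzP : NthDigitZero (m + 1 + 1) P := h.hasDigits.nthDigitZero
  intro c b hb
  rw [lineCount_union hS.2.1 h.isPointSet.2.1 (h.disjoint hS hl)]
  rcases digit_eq_zero_or_one b 0 with h0 | h0
  · have hex : ∃ a < fibUp ((m + 1 : ℕ) : ℤ), b = shift a := by
      obtain ⟨a, rfl | ⟨ha, rfl⟩⟩ := exists_shift b
      · exact ⟨a, shift_lt_fibUp_iff.1 hb, rfl⟩
      · rw [digit_shift_add_one_zero ha] at h0; lia
    obtain ⟨a, ha, rfl⟩ := hex
    rw [NthDigitZero.lineCount_shift (k := m + 1) hz hS.2.1 c ha,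
      hzP.lineCount_shift h.isPointSet.2.1 c ha, hl c a ha, h.lineCount_eq c a ha, h0,
      show (m : ℤ) + 1 - ((m + 2 + 0 : ℕ) : ℤ) = -1 by lia]
    rcases digit_eq_zero_or_one a 0 with h1 | h1 <;> rw [h1]
    · rw [show (m : ℤ) - ((m + 1 + 0 : ℕ) : ℤ) = -1 by lia, add_zero]
    · rw [show (m : ℤ) - ((m + 1 + 1 : ℕ) : ℤ) = -2 by lia]; rfl
  · rw [hz.lineCount_eq_zero c hb h0, hzP.lineCount_eq_zero c hb h0, h0,
      show (m : ℤ) + 1 - ((m + 2 + 1 : ℕ) : ℤ) = -2 by lia]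
    rfl

theorem IsComplement.isNet_union (h : IsComplement m S P) (hS : IsNet 1 (m : ℤ) S)
    (hl : IsLineUniform (m : ℤ) S (m + 1)) (hz : NthDigitZero (m + 2) S) :
    IsNet 1 ((m : ℤ) + 1) (S ∪ P) := by
  have hd := h.disjoint hS.1 hl
  have hU := h.isPointSet_union hS.1 hd
  have hlU := h.isLineUniform_union hS.1 hl hz
  refine isNet_of_isUniform hU fun k hk ↦ ?_
  rw [rho_two] at hk
  have hline : ∀ i ≤ m + 2, IsLineUniform ((m : ℤ) + 1) (S ∪ P) i := fun i hi ↦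
    hlU.of_le hU.2.1 hi (by lia)
  by_cases h0 : k 0 = 0
  · rw [h0]
    refine ((isLineUniform_iff hU.1 _).1 (hline (k 1) ?_)).2
    split_ifs at hk <;> lia
  by_cases h1 : k 1 = 0
  · rw [h1]
    refine ((isLineUniform_iff hU.1 _).1 (hline (k 0) ?_)).1
    split_ifs at hk <;> lia
  rw [if_pos h0, if_pos h1] at hk
  push_cast at hk
  intro u hu v hv
  rw [boxCount_union hS.1.2.1 h.isPointSet.2.1 hd]
  by_cases hlt : k 0 + k 1 < m
  · have hr : (rho k : ℤ) ≤ (m : ℤ) + 2 - (1 : ℕ) := by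
      rw [rho_two, if_pos h0, if_pos h1]; lia
    rw [(isStronglyEquidistributed_iff.1 (hS.isStronglyEquidistributed hr)).2 u hu v hv,
      h.isUniform_of_lt hlt u hu v hv]
    have hu1 := digit_eq_zero_or_one u 0
    have hv1 := digit_eq_zero_or_one v 0
    rw [fibUp_eq_add (e := (m : ℤ) + 1 - _) (by lia)]
    congr 2 <;> ring
  · obtain ⟨i, hi⟩ := Nat.exists_eq_succ_of_ne_zero h0
    obtain ⟨j, hj⟩ := Nat.exists_eq_succ_of_ne_zero h1
    rw [hi, hj] at hlt hk
    rw [hi] at hu ⊢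
    rw [hj] at hv ⊢
    rw [h.boxCount_add i j (by lia) u hu v hv, capacity]
    congr 1
    push_cast at hk ⊢
    lia

end complement

theorem IsNet.exists_extension {m : ℕ} {S : Set (Fin 2 → ℝ)} (hS : IsNet 1 (m : ℤ) S)
    (h0 : IsStronglyEquidistributed m ![m + 1, 0] S)
    (h1 : IsStronglyEquidistributed m ![0, m + 1] S) (hz : NthDigitZero (m + 2) S) :
    ∃ P : Set (Fin 2 → ℝ), IsNet 0 ((m : ℤ) - 1) P ∧ HasDigits (m + 1) P ∧ Disjoint S P ∧
      IsNet 1 ((m : ℤ) + 1) (S ∪ P) ∧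
      IsStronglyEquidistributed ((m : ℤ) + 1) ![m + 2, 0] (S ∪ P) ∧
      IsStronglyEquidistributed ((m : ℤ) + 1) ![0, m + 2] (S ∪ P) := by
  obtain ⟨P, h⟩ := exists_isComplement hS
  have hl := isLineUniform_of_isStronglyEquidistributed h0 h1
  have hd := h.disjoint hS.1 hl
  have hU := h.isPointSet_union hS.1 hd
  have hlU := (isLineUniform_iff hU.1 _).1 (h.isLineUniform_union hS.1 hl hz)
  exact ⟨P, h.isNet, h.hasDigits, hd, h.isNet_union hS hl hz,
    isStronglyEquidistributed_iff.2 ⟨hU, hlU.1⟩, isStronglyEquidistributed_iff.2 ⟨hU, hlU.2⟩⟩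

/-! ### Iterated extension -/

/-- The nets to which the extension step applies repeatedly. -/
structure IsExtensible (m : ℕ) (S : Set (Fin 2 → ℝ)) : Prop where
  isNet : IsNet 1 (m : ℤ) S
  fst : IsStronglyEquidistributed m ![m + 1, 0] S
  snd : IsStronglyEquidistributed m ![0, m + 1] S
  hasDigits : HasDigits m S

theorem isExtensible_zero : IsExtensible 0 {0} := by
  have hP : IsPointSet ((0 : ℕ) : ℤ) ({0} : Set (Fin 2 → ℝ)) := by
    refine ⟨?_, Set.finite_singleton _, ?_⟩
    · rintro _ rfl _; simp
    · rw [Set.ncard_singleton]; rfl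
  have hmem : (0 : ℝ) ∈ elemIco 1 0 := by
    simpa [whole_zero] using left_mem_elemIco 1 0
  have hd : digit 1 0 = 1 := by
    have := digit_shift_add_one_zero (digit_zero_left 0)
    rwa [shift_zero] at this
  have hl : IsLineUniform ((0 : ℕ) : ℤ) {(0 : Fin 2 → ℝ)} 1 := by
    intro c b hb
    have hb2 : b < 2 := hb
    rw [lineCount]
    interval_cases b
    · rw [digit_zero_left, Set.inter_eq_left.2, Set.ncard_singleton]
      · rfl
      · rintro _ rfl; exact hmem
    · have : ({0} ∩ {x | x c ∈ elemIco 1 1} : Set (Fin 2 → ℝ)) = ∅ := by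
        refine Set.eq_empty_iff_forall_notMem.2 ?_
        rintro _ ⟨rfl, h⟩
        exact absurd (elemIco_disjoint h hmem) (by lia)
      rw [this, Set.ncard_empty, hd]
      rfl
  have hl' := (isLineUniform_iff hP.1 1).1 hl
  refine ⟨isNet_of_isUniform hP fun k hk ↦ ?_, isStronglyEquidistributed_iff.2 ⟨hP, hl'.1⟩,
    isStronglyEquidistributed_iff.2 ⟨hP, hl'.2⟩, ?_⟩
  · have h0 : k 0 = 0 ∧ k 1 = 0 := by
      rw [rho_two] at hk
      push_cast at hk
      split_ifs at hk <;> lia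
    rw [h0.1, h0.2]
    exact ((isLineUniform_iff hP.1 0).1
      (hl.of_le (Set.finite_singleton _) zero_le_one (by simp))).1
  · rintro _ rfl _
    exact ⟨0, by simp [fibUp], by simp [whole_zero]⟩

theorem IsExtensible.exists_succ {m : ℕ} {S : Set (Fin 2 → ℝ)} (h : IsExtensible m S) :
    ∃ P : Set (Fin 2 → ℝ), IsNet 0 ((m : ℤ) - 1) P ∧ IsExtensible (m + 1) (S ∪ P) := by
  obtain ⟨P, h1, h2, -, h3, h4, h5⟩ :=
    h.isNet.exists_extension h.fst h.snd h.hasDigits.succ.nthDigitZero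
  refine ⟨P, h1, by exact_mod_cast h3, by exact_mod_cast h4, by exact_mod_cast h5, ?_⟩
  rintro x (hx | hx)
  · exact h.hasDigits.succ x hx
  · exact h2 x hx

/-- Finite sets `P m` whose sizes are the lengths of the consecutive blocks
`F^m ≤ n < F^{m+1}` can be enumerated one after the other, starting at `n = 1`. -/
theorem exists_enumeration {α : Type*} (x₀ : α) (P : ℕ → Set α) (hfin : ∀ m, (P m).Finite)
    (hcard : ∀ m : ℕ, (P m).ncard = fibUp ((m : ℤ) - 1)) :
    ∃ x : ℕ → α, x 0 = x₀ ∧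
      ∀ m : ℕ, x '' Set.Ico (fibUp m) (fibUp ((m : ℤ) + 1)) = P m := by
  have hblock : ∀ m : ℕ, ∃ e : ℕ → α, e '' Set.Ico (fibUp m) (fibUp ((m : ℤ) + 1)) = P m := by
    intro m
    have h1 : (Set.Ico (fibUp m) (fibUp ((m : ℤ) + 1))).ncard = (P m).ncard := by
      rw [hcard, fibUp_eq_add (e := (m : ℤ) + 1) (by lia)]
      simp only [Set.ncard_eq_toFinset_card', Set.toFinset_Ico, Nat.card_Ico]
      rw [add_sub_cancel_right, show (m : ℤ) + 1 - 2 = m - 1 by ring]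
      lia
    have : Nonempty α := ⟨x₀⟩
    obtain ⟨e, he⟩ := (Set.finite_Ico _ _).exists_bijOn_of_encard_eq (β := α) (t := P m) (by
      rw [← (hfin m).cast_ncard_eq, ← (Set.finite_Ico (fibUp m) _).cast_ncard_eq, h1])
    exact ⟨e, he.image_eq⟩
  choose e he using hblock
  -- `greatestFib n - 2` is the number `m` of the block to which `n > 0` belongs.
  refine ⟨fun n ↦ if n = 0 then x₀ else e (n.greatestFib - 2) n, if_pos rfl, fun m ↦ ?_⟩
  rw [← he m]
  refine Set.image_congr fun n hn ↦ ?_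
  have h2 : fibUp ((m : ℤ) + 1) = Nat.fib (m + 3) := fibUp_natCast (m + 1)
  rw [fibUp_natCast, h2] at hn
  have hpos : n ≠ 0 := (lt_of_lt_of_le (Nat.fib_pos.2 (by lia)) hn.1).ne'
  have h3 := Nat.le_greatestFib.2 hn.1
  have h4 := Nat.greatestFib_lt.2 hn.2
  rw [if_neg hpos, show n.greatestFib - 2 = m by lia]

theorem exists_weakSequence : ∃ x : ℕ → Fin 2 → ℝ, x 0 = 0 ∧
    ∀ m : ℕ, IsExtensible m (firstPoints x m) ∧
      IsNet 0 ((m : ℤ) - 1) (x '' Set.Ico (fibUp m) (fibUp ((m : ℤ) + 1))) := by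
  choose! Q hQ using fun (m : ℕ) (S : Set (Fin 2 → ℝ)) (h : IsExtensible m S) ↦ h.exists_succ
  let S : ℕ → Set (Fin 2 → ℝ) := fun m ↦ Nat.rec {0} (fun m S ↦ S ∪ Q m S) m
  have hS : ∀ m, IsExtensible m (S m) := fun m ↦ by
    induction m with
    | zero => exact isExtensible_zero
    | succ m ih => exact (hQ m _ ih).2
  have hP : ∀ m : ℕ, IsNet 0 ((m : ℤ) - 1) (Q m (S m)) := fun m ↦ (hQ m _ (hS m)).1
  obtain ⟨x, hx0, hx⟩ := exists_enumeration (0 : Fin 2 → ℝ) (fun m ↦ Q m (S m))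
    (fun m ↦ (hP m).1.2.1) fun m ↦ (hP m).1.2.2
  have hfirst : ∀ m, firstPoints x m = S m := fun m ↦ by
    induction m with
    | zero =>
      have : Set.Iio (fibUp ((0 : ℕ) : ℤ)) = {0} := by ext n; simp [fibUp]
      rw [firstPoints, this, Set.image_singleton, hx0]
      rfl
    | succ m ih =>
      have h1 : Set.Iio (fibUp ((m + 1 : ℕ) : ℤ)) =
          Set.Iio (fibUp m) ∪ Set.Ico (fibUp m) (fibUp ((m : ℤ) + 1)) := by
        rw [Set.Iio_union_Ico_eq_Iio, Nat.cast_add_one]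
        rw [fibUp_eq_add (e := (m : ℤ) + 1) (by lia), add_sub_cancel_right]
        exact Nat.le_add_right _ _
      rw [firstPoints, h1, Set.image_union, hx m, ← firstPoints, ih]
  exact ⟨x, hx0, fun m ↦ ⟨hfirst m ▸ hS m, (hx m).symm ▸ hP m⟩⟩

end GoldenNet

theorem mainTheorem3 :
    -- extension of nets
    (∀ (m : ℕ) (S : Set (Fin 2 → ℝ)),
      GoldenNet.IsNet 1 m S →
      GoldenNet.IsStronglyEquidistributed m ![m + 1, 0] S →
      GoldenNet.IsStronglyEquidistributed m ![0, m + 1] S →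
      GoldenNet.NthDigitZero (m + 2) S →
      ∃ P : Set (Fin 2 → ℝ),
        GoldenNet.IsNet 0 ((m : ℤ) - 1) P ∧
        GoldenNet.HasDigits (m + 1) P ∧
        Disjoint S P ∧
        GoldenNet.IsNet 1 ((m : ℤ) + 1) (S ∪ P) ∧
        GoldenNet.IsStronglyEquidistributed ((m : ℤ) + 1) ![m + 2, 0] (S ∪ P) ∧
        GoldenNet.IsStronglyEquidistributed ((m : ℤ) + 1) ![0, m + 2] (S ∪ P)) ∧
    -- a weak (1,2)-sequence obtained from the origin by repeated extension
    (∃ x : ℕ → Fin 2 → ℝ,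
      x 0 = 0 ∧
      GoldenNet.IsWeakSequence 1 x ∧
      ∀ m : ℕ,
        GoldenNet.IsNet 1 m (GoldenNet.firstPoints x m) ∧
        GoldenNet.IsStronglyEquidistributed m ![m + 1, 0] (GoldenNet.firstPoints x m) ∧
        GoldenNet.IsStronglyEquidistributed m ![0, m + 1] (GoldenNet.firstPoints x m) ∧
        GoldenNet.HasDigits m (GoldenNet.firstPoints x m) ∧
        GoldenNet.IsNet 0 ((m : ℤ) - 1)
          (x '' Set.Ico (GoldenNet.fibUp m) (GoldenNet.fibUp ((m : ℤ) + 1)))) := by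
  refine ⟨fun m S hS h0 h1 hz ↦ hS.exists_extension h0 h1 hz, ?_⟩
  obtain ⟨x, hx0, hx⟩ := GoldenNet.exists_weakSequence
  exact ⟨x, hx0, fun m _ ↦ (hx m).1.isNet, fun m ↦
    ⟨(hx m).1.isNet, (hx m).1.fst, (hx m).1.snd, (hx m).1.hasDigits, (hx m).2⟩⟩
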